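/- Let $X=\{F=0\}\subset\mathbb{P}^4$ be a smooth complex cubic threefold. A line $\ell\subset X$ is of the second type if there is a unique plane $P\supset\ell$ such that $P\cap X=2\ell\cup\ell'$ (as divisors on $P$) for some line $\ell'$, and it is a triple line if there is a plane $P\supset\ell$ with $P\cap X=3\ell$. Let $M(X)$ be the curve of lines of the second type on the Fano surface of lines of $X$, given in the affine chart $p_{i,j}=1$ of the Grassmannian of lines as follows: the lines of the chart are spanned by $v_0=e_i+\sum_k a_{0,k}e_k$ and $v_1=e_j+\sum_k a_{1,k}e_k$, where $k$ runs over the three indices different from $i,j$; the equations of $M(X)$ in the six coordinates $a_{u,k}$ are the vanishing of the four coefficients of the binary cubic $F(t_0v_0+t_1v_1)$, together with the vanishing of the determinant of the $3\times 3$ matrix of the coefficients of the three binary quadratic forms $\frac{\partial F}{\partial x_k}(t_0v_0+t_1v_1)$, $k\ne i,j$. Then: 1. the closed points of the scheme $M(X)$ are exactly the lines of the second type on $X$; 2. the singular points of $M(X)$ (the closed points at which its local ring is not regular) are exactly the triple lines on $X$; 3. $M(X)$ is reduced. -/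

import Mathlib

noncomputable section

namespace CubicThreefold

/-- The hypersurface `F = 0` in `ℙ⁴` (for `F` homogeneous) is smooth: the partial derivatives of `F`
have no common zero on it. -/
def IsSmooth (F : MvPolynomial (Fin 5) ℂ) : Prop :=
  ∀ x : Fin 5 → ℂ, x ≠ 0 → MvPolynomial.eval x F = 0 →
    ∃ i, MvPolynomial.eval x (MvPolynomial.pderiv i F) ≠ 0

/-! Lines and planes of `ℙ⁴` are the linear subspaces of `ℂ⁵` of dimension `2` and `3`. -/

/-- `P` is a plane, `L` and `L'` are lines contained in `P`, and the plane cubic `P ∩ X` is the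
divisor `2L + L'` on `P`: there are linear forms `l` and `m` whose restrictions to `P` are
equations of `L` and of `L'`, and `F` restricted to `P` is `l² m`. -/
def PlaneSection (F : MvPolynomial (Fin 5) ℂ) (P L L' : Submodule ℂ (Fin 5 → ℂ)) : Prop :=
  Module.finrank ℂ P = 3 ∧ Module.finrank ℂ L = 2 ∧ Module.finrank ℂ L' = 2 ∧
    ∃ l m : Module.Dual ℂ (Fin 5 → ℂ),
      P ⊓ LinearMap.ker l = L ∧ P ⊓ LinearMap.ker m = L' ∧
        ∀ x ∈ P, MvPolynomial.eval x F = l x ^ 2 * m x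

/-- `L` is a line of the second type on `X`: there is a unique plane `P ⊃ L` with
`P ∩ X = 2L ∪ L'` for some line `L'`. -/
def IsSecondType (F : MvPolynomial (Fin 5) ℂ) (L : Submodule ℂ (Fin 5 → ℂ)) : Prop :=
  ∃! P : Submodule ℂ (Fin 5 → ℂ), ∃ L', PlaneSection F P L L'

/-- `L` is a triple line on `X`: there is a plane `P ⊃ L` with `P ∩ X = 3L`. -/
def IsTripleLine (F : MvPolynomial (Fin 5) ℂ) (L : Submodule ℂ (Fin 5 → ℂ)) : Prop :=
  ∃ P : Submodule ℂ (Fin 5 → ℂ), PlaneSection F P L L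

/-! ### The standard affine charts of the Grassmannian of lines

A chart is given by a splitting `e : Fin 2 ⊕ Fin 3 ≃ Fin 5` of the five homogeneous coordinates.
With `i = e (inl 0)` and `j = e (inl 1)` it is the chart `p_{i,j} ≠ 0`; it is isomorphic to `ℂ⁶`, and
its coordinates `X (u, k)` are, up to signs, the other Plücker coordinates involving `i` or `j`,
normalised by `p_{i,j} = 1`. -/

/-- The coordinate ring of a chart. -/
abbrev ChartRing : Type := MvPolynomial (Fin 2 × Fin 3) ℂ

/-- The two points `v₀`, `v₁` spanning the general line of a chart: `v_u` has coordinate `1` at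
`e (inl u)`, coordinate `0` at the other `e (inl u')`, and coordinate `X (u, k)` at `e (inr k)`. -/
def chartVec (e : Fin 2 ⊕ Fin 3 ≃ Fin 5) (u : Fin 2) (i : Fin 5) : ChartRing :=
  Sum.elim (fun u' => if u' = u then 1 else 0) (fun k => MvPolynomial.X (u, k)) (e.symm i)

/-- The line with coordinates `a` in a chart. -/
def chartLine (e : Fin 2 ⊕ Fin 3 ≃ Fin 5) (a : Fin 2 × Fin 3 → ℂ) : Submodule ℂ (Fin 5 → ℂ) :=
  Submodule.span ℂ (Set.range fun (u : Fin 2) (i : Fin 5) => MvPolynomial.eval a (chartVec e u i))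

/-- The coefficient of `t₀ⁱ t₁ʲ` in `G (t₀ v₀ + t₁ v₁)`, a polynomial function on the chart. -/
def lineCoeff (e : Fin 2 ⊕ Fin 3 ≃ Fin 5) (G : MvPolynomial (Fin 5) ℂ) (i j : ℕ) : ChartRing :=
  MvPolynomial.coeff (Finsupp.single (0 : Fin 2) i + Finsupp.single (1 : Fin 2) j)
    (MvPolynomial.aeval
      (fun n : Fin 5 => ∑ u : Fin 2,
        (MvPolynomial.X u * MvPolynomial.C (chartVec e u n) : MvPolynomial (Fin 2) ChartRing)) G)

/-- The determinant of the `3 × 3` matrix whose columns are the coefficients (at `t₀²`, `t₀ t₁`,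
`t₁²`) of the three partial derivatives `∂F/∂x_{e (inr k)}` along the general line. -/
def secondTypeDet (e : Fin 2 ⊕ Fin 3 ≃ Fin 5) (F : MvPolynomial (Fin 5) ℂ) : ChartRing :=
  Matrix.det (Matrix.of fun r k : Fin 3 =>
    lineCoeff e (MvPolynomial.pderiv (e (Sum.inr k)) F) (2 - (r : ℕ)) (r : ℕ))

/-- The ideal of the curve `M(X)` of lines of the second type in a chart: the four equations of the
Fano surface `F(X)`, and the equation of `M(X)` in `F(X)`. -/
def curveIdeal (e : Fin 2 ⊕ Fin 3 ≃ Fin 5) (F : MvPolynomial (Fin 5) ℂ) : Ideal ChartRing :=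
  Ideal.span {lineCoeff e F 3 0, lineCoeff e F 2 1, lineCoeff e F 1 2, lineCoeff e F 0 3,
    secondTypeDet e F}

/-- The coordinate ring of `M(X)` in a chart. -/
abbrev CurveRing (e : Fin 2 ⊕ Fin 3 ≃ Fin 5) (F : MvPolynomial (Fin 5) ℂ) : Type :=
  ChartRing ⧸ curveIdeal e F

/-- The point with coordinates `a` of the chart lies on `M(X)`. -/
def MemCurve (e : Fin 2 ⊕ Fin 3 ≃ Fin 5) (F : MvPolynomial (Fin 5) ℂ)
    (a : Fin 2 × Fin 3 → ℂ) : Prop :=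
  ∀ f ∈ curveIdeal e F, MvPolynomial.eval a f = 0

/-- The maximal ideal of a closed point of `M(X)` in the coordinate ring of `M(X)` in a chart: the
kernel of the evaluation at that point. -/
def pointIdeal {e : Fin 2 ⊕ Fin 3 ≃ Fin 5} {F : MvPolynomial (Fin 5) ℂ}
    {a : Fin 2 × Fin 3 → ℂ} (h : MemCurve e F a) : Ideal (CurveRing e F) :=
  RingHom.ker (Ideal.Quotient.lift (curveIdeal e F) (MvPolynomial.eval a) h)

instance pointIdeal_isPrime {e : Fin 2 ⊕ Fin 3 ≃ Fin 5} {F : MvPolynomial (Fin 5) ℂ}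
    {a : Fin 2 × Fin 3 → ℂ} (h : MemCurve e F a) : (pointIdeal h).IsPrime :=
  RingHom.ker_isPrime _

/-- `L` is a singular point of the curve `M(X)`: it is a point of `M(X)` at which the local ring of
`M(X)`, computed in a chart containing `L`, is not regular. -/
def IsSingularPoint (F : MvPolynomial (Fin 5) ℂ) (L : Submodule ℂ (Fin 5 → ℂ)) : Prop :=
  ∃ (e : Fin 2 ⊕ Fin 3 ≃ Fin 5) (a : Fin 2 × Fin 3 → ℂ) (h : MemCurve e F a),
    chartLine e a = L ∧ ¬ IsRegularLocalRing (Localization.AtPrime (pointIdeal h))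

end CubicThreefold

end

/-!
Let `v₀`, `v₁` span a line `L` of `X`. A plane `⟨L, n⟩` is tangent to `X` along `L` iff the three
numbers `F(v₀, v₀, n)`, `F(v₀, v₁, n)`, `F(v₁, v₁, n)` vanish, where `F(·, ·, ·)` is the
polarization; for `n` in a complement of `L` these are linear equations with matrix `M`, and
`det M = 0` is the equation of the curve in the Fano surface. By smoothness, no element
`(p², 2pq, q²)` of the conic is in the left kernel of `M`, so `M` has rank at least `2` and the
tangent plane is unique.

At a point of the curve, the Fano surface is smooth, with tangent space the pairs `(l₀ n, l₁ n)`.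
The left kernel of `M` is spanned by `ρ` with nonzero discriminant `ρ₁² - 4ρ₀ρ₂`. The differential
of `det M` at `(l₀ n, l₁ n)` is the bilinear form of `ρ` applied to `l` and
`m = (F(v₀, n, n), F(v₁, n, n))`, so it vanishes iff `m = 0`, that is, iff `L` is triple. If
`m ≠ 0` the curve is smooth at `L` by the Jacobian criterion. If `m = 0` the quadratic term of
`det M` is `F(n) (ρ₀ l₀² + ρ₁ l₀ l₁ + ρ₂ l₁²)` with `F(n) ≠ 0`, a nondegenerate binary form: the
curve has an ordinary node, so it is reduced but not regular there.
-/

noncomputable section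

namespace CubicThreefold

/-! ### Regularity and nodes of local rings -/

section LocalRing

open IsLocalRing PowerSeries

variable {R k : Type*} [CommRing R] [IsLocalRing R] [Field k]

lemma le_of_le_sup_maximalIdeal_mul [IsNoetherianRing R] {I J : Ideal R}
    (h : I ≤ J ⊔ maximalIdeal R * I) : I ≤ J :=
  Submodule.le_of_le_smul_of_le_jacobson_bot (IsNoetherian.noetherian _)
    (jacobson_eq_maximalIdeal _ bot_ne_top).ge h

lemma constantCoeff_eq_zero_of_mem_maximalIdeal (φ : R →+* k⟦X⟧) [IsLocalHom φ] {f : R}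
    (hf : f ∈ maximalIdeal R) : constantCoeff (φ f) = 0 := by
  by_contra h
  exact hf (isUnit_of_map_unit φ f (isUnit_iff_constantCoeff.mpr (isUnit_iff_ne_zero.mpr h)))

lemma X_pow_dvd_of_mem_maximalIdeal_pow (φ : R →+* k⟦X⟧) [IsLocalHom φ] {f : R} {n : ℕ}
    (hf : f ∈ maximalIdeal R ^ n) : X ^ n ∣ φ f := by
  have hle : maximalIdeal R ≤ (Ideal.span {(X : k⟦X⟧)}).comap φ := fun g hg => by
    rw [Ideal.mem_comap, Ideal.mem_span_singleton, X_dvd_iff]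
    exact constantCoeff_eq_zero_of_mem_maximalIdeal φ hg
  have := (Ideal.pow_right_mono hle n).trans (Ideal.le_comap_pow _ n) hf
  rwa [Ideal.mem_comap, Ideal.span_singleton_pow, Ideal.mem_span_singleton] at this

lemma eq_zero_of_forall_mem_maximalIdeal_pow [IsNoetherianRing R] {f : R}
    (h : ∀ n, f ∈ maximalIdeal R ^ n) : f = 0 := by
  have := Ideal.iInf_pow_eq_bot_of_isLocalRing _ (Ideal.IsPrime.ne_top' (I := maximalIdeal R))
  rwa [← Ideal.mem_bot, ← this, Ideal.mem_iInf]

lemma injective_of_maximalIdeal_eq_span_singleton [IsNoetherianRing R] {x : R}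
    (hx : maximalIdeal R = Ideal.span {x}) (φ : R →+* k⟦X⟧) (hφx : φ x ≠ 0) :
    Function.Injective φ := by
  rw [injective_iff_map_eq_zero]
  refine fun f hf => eq_zero_of_forall_mem_maximalIdeal_pow fun n => ?_
  induction n with
  | zero => simp
  | succ n ih =>
    rw [hx, Ideal.span_singleton_pow, Ideal.mem_span_singleton] at ih
    obtain ⟨u, rfl⟩ := ih
    rw [map_mul, map_pow, mul_eq_zero_iff_left (pow_ne_zero n hφx)] at hf
    have hu : u ∈ maximalIdeal R := fun hunit => (hunit.map φ).ne_zero hf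
    rw [mul_comm, pow_succ']
    exact Ideal.mul_mem_mul hu (Ideal.pow_mem_pow (hx ▸ Ideal.mem_span_singleton_self x) n)

theorem isReduced_and_isRegularLocalRing_of_maximalIdeal_eq_span_singleton [IsNoetherianRing R]
    {x : R} (hx : maximalIdeal R = Ideal.span {x}) (φ : R →+* k⟦X⟧) (hφx : φ x ≠ 0) :
    IsReduced R ∧ IsRegularLocalRing R := by
  have := (injective_of_maximalIdeal_eq_span_singleton hx φ hφx).isDomain φ
  have : IsPrincipalIdealRing R :=
    ((tfae_of_isNoetherianRing_of_isLocalRing_of_isDomain R).out 4 0).mp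
      (show (maximalIdeal R).IsPrincipal from ⟨x, hx⟩)
  exact ⟨inferInstance, inferInstance⟩

/-- A local ring is nodal along `φ` and `ψ` if its tangent cone is the pair of crossing lines
`x y = 0` and if each of the two lines is tangent to an arc, `φ` or `ψ`. -/
structure IsNode (x y : R) (φ ψ : R →+* k⟦X⟧) : Prop where
  maximalIdeal_eq : maximalIdeal R = Ideal.span {x, y}
  mul_mem : x * y ∈ maximalIdeal R ^ 3
  isLocalHom_left : IsLocalHom φ
  isLocalHom_right : IsLocalHom ψ
  coeff_left_x : coeff 1 (φ x) = 1
  coeff_left_y : coeff 1 (φ y) = 0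
  coeff_right_x : coeff 1 (ψ x) = 0
  coeff_right_y : coeff 1 (ψ y) = 1

namespace IsNode

variable {x y : R} {φ ψ : R →+* k⟦X⟧} (h : IsNode x y φ ψ)
include h

lemma symm : IsNode y x ψ φ where
  maximalIdeal_eq := by rw [h.maximalIdeal_eq, Set.pair_comm]
  mul_mem := mul_comm x y ▸ h.mul_mem
  isLocalHom_left := h.isLocalHom_right
  isLocalHom_right := h.isLocalHom_left
  coeff_left_x := h.coeff_right_y
  coeff_left_y := h.coeff_right_x
  coeff_right_x := h.coeff_left_y
  coeff_right_y := h.coeff_left_x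

lemma left_mem : x ∈ maximalIdeal R := h.maximalIdeal_eq ▸ Ideal.subset_span (by simp)

lemma maximalIdeal_pow_le (n : ℕ) : maximalIdeal R ^ (n + 1) ≤
    Ideal.span {x ^ (n + 1), y ^ (n + 1)} ⊔ maximalIdeal R ^ (n + 2) := by
  induction n with
  | zero => simpa using h.maximalIdeal_eq.le.trans le_sup_left
  | succ n ih =>
    have hxy (m : ℕ) : x ^ (m + 1) * y ∈ maximalIdeal R ^ (m + 3) := by
      rw [pow_succ x, mul_assoc, pow_add _ m 3]
      exact Ideal.mul_mem_mul (Ideal.pow_mem_pow h.left_mem m) h.mul_mem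
    have hyx (m : ℕ) : y ^ (m + 1) * x ∈ maximalIdeal R ^ (m + 3) := by
      rw [pow_succ y, mul_assoc, pow_add _ m 3]
      exact Ideal.mul_mem_mul (Ideal.pow_mem_pow h.symm.left_mem m) h.symm.mul_mem
    calc maximalIdeal R ^ (n + 2)
      _ = maximalIdeal R ^ (n + 1) * maximalIdeal R := pow_succ _ _
      _ ≤ (Ideal.span {x ^ (n + 1), y ^ (n + 1)} ⊔ maximalIdeal R ^ (n + 2)) * maximalIdeal R :=
        Ideal.mul_mono_left ih
      _ = Ideal.span {x ^ (n + 1), y ^ (n + 1)} * Ideal.span {x, y} ⊔ maximalIdeal R ^ (n + 3) := by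
        rw [Ideal.sup_mul, ← pow_succ, ← h.maximalIdeal_eq]
      _ ≤ _ := by
        refine sup_le ?_ le_sup_right
        rw [Ideal.span_mul_span', Ideal.span_le]
        rintro _ ⟨_, rfl | rfl, _, rfl | rfl, rfl⟩
        · exact Ideal.mem_sup_left (Ideal.subset_span (Or.inl (pow_succ _ _).symm))
        · exact Ideal.mem_sup_right (hxy n)
        · exact Ideal.mem_sup_right (hyx n)
        · exact Ideal.mem_sup_left (Ideal.subset_span (Or.inr (pow_succ _ _).symm))

lemma mem_of_map_eq_zero {n : ℕ} {α β c : R} (hc : c ∈ maximalIdeal R ^ (n + 2))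
    (hφ : φ (α * x ^ (n + 1) + β * y ^ (n + 1) + c) = 0) : α ∈ maximalIdeal R := by
  have := h.isLocalHom_left
  obtain ⟨u, hu⟩ := X_pow_dvd_of_mem_maximalIdeal_pow φ (n := 1) (by simpa using h.left_mem)
  rw [pow_one] at hu
  obtain ⟨v, hv⟩ : X ^ 2 ∣ φ y := X_pow_dvd_iff.mpr fun m hm => by
    interval_cases m
    · rw [coeff_zero_eq_constantCoeff_apply]
      exact constantCoeff_eq_zero_of_mem_maximalIdeal φ h.symm.left_mem
    · exact h.coeff_left_y
  obtain ⟨w, hw⟩ := X_pow_dvd_of_mem_maximalIdeal_pow φ hc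
  have hu1 : constantCoeff u = 1 := by
    rw [← h.coeff_left_x, hu, coeff_succ_X_mul, coeff_zero_eq_constantCoeff_apply]
  have hfactor : X ^ (n + 1) * (φ α * u ^ (n + 1) + X * (φ β * v ^ (n + 1) * X ^ n + w)) = 0 := by
    rw [← hφ, map_add, map_add, map_mul, map_mul, map_pow, map_pow, hu, hv, hw]
    ring
  have hconst := congrArg constantCoeff
    ((mul_eq_zero_iff_left (pow_ne_zero _ X_ne_zero)).mp hfactor)
  simp only [map_add, map_mul, map_pow, hu1, one_pow, mul_one, constantCoeff_X, zero_mul, add_zero,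
    map_zero] at hconst
  exact fun hunit => ((hunit.map φ).map constantCoeff).ne_zero hconst

lemma eq_zero_of_map_eq_zero [IsNoetherianRing R] {f : R} (hφ : φ f = 0) (hψ : ψ f = 0) :
    f = 0 := by
  have hf : f ∈ maximalIdeal R := fun hunit => (hunit.map φ).ne_zero hφ
  refine eq_zero_of_forall_mem_maximalIdeal_pow fun n => ?_
  rcases n with _ | n
  · simp
  induction n with
  | zero => simpa using hf
  | succ n ih =>
    obtain ⟨_, hg, c, hc, rfl⟩ := Submodule.mem_sup.mp (h.maximalIdeal_pow_le n ih)
    obtain ⟨α, β, rfl⟩ := Ideal.mem_span_pair.mp hg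
    have hα := h.mem_of_map_eq_zero hc hφ
    have hβ := h.symm.mem_of_map_eq_zero hc (by rwa [add_comm (β * _)])
    refine add_mem (add_mem ?_ ?_) hc <;> rw [pow_succ']
    · exact Ideal.mul_mem_mul hα (Ideal.pow_mem_pow h.left_mem _)
    · exact Ideal.mul_mem_mul hβ (Ideal.pow_mem_pow h.symm.left_mem _)

theorem isReduced [IsNoetherianRing R] : IsReduced R where
  eq_zero _ hf := h.eq_zero_of_map_eq_zero (hf.map φ).eq_zero (hf.map ψ).eq_zero

lemma maximalIdeal_sq_le [IsNoetherianRing R] : maximalIdeal R ^ 2 ≤ Ideal.span {x + y} := by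
  refine le_of_le_sup_maximalIdeal_mul ((h.maximalIdeal_pow_le 1).trans ?_)
  rw [← pow_succ', sup_le_iff, Ideal.span_le, Set.pair_subset_iff]
  have hsum : x + y ∈ Ideal.span {x + y} := Ideal.mem_span_singleton_self _
  refine ⟨⟨?_, ?_⟩, le_sup_right⟩
  · rw [show x ^ (1 + 1) = x * (x + y) - x * y by ring]
    exact sub_mem (Ideal.mem_sup_left (Ideal.mul_mem_left _ _ hsum)) (Ideal.mem_sup_right h.mul_mem)
  · rw [show y ^ (1 + 1) = y * (x + y) - x * y by ring]
    exact sub_mem (Ideal.mem_sup_left (Ideal.mul_mem_left _ _ hsum)) (Ideal.mem_sup_right h.mul_mem)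

lemma ringKrullDim_le_one [IsNoetherianRing R] : ringKrullDim R ≤ 1 := by
  rw [← maximalIdeal_height_eq_ringKrullDim]
  have hmin : maximalIdeal R ∈ (Ideal.span {x + y}).minimalPrimes :=
    ⟨⟨inferInstance, (Ideal.span_singleton_le_iff_mem _).mpr
        (add_mem h.left_mem h.symm.left_mem)⟩,
      fun q hq _ => hq.1.le_of_pow_le (h.maximalIdeal_sq_le.trans hq.2)⟩
  exact_mod_cast Ideal.height_le_one_of_isPrincipal_of_mem_minimalPrimes _ _ hmin

lemma not_isPrincipal : ¬ (maximalIdeal R).IsPrincipal := by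
  rintro ⟨t, ht⟩
  have := h.isLocalHom_left
  have := h.isLocalHom_right
  have htm : t ∈ maximalIdeal R := ht ▸ Ideal.mem_span_singleton_self t
  have hcoeff (χ : R →+* k⟦X⟧) [IsLocalHom χ] (s : R) :
      coeff 1 (χ (t * s)) = coeff 1 (χ t) * constantCoeff (χ s) := by
    rw [map_mul, coeff_one_mul, constantCoeff_eq_zero_of_mem_maximalIdeal χ htm]
    ring
  obtain ⟨r, rfl⟩ := Ideal.mem_span_singleton.mp (ht ▸ h.left_mem)
  obtain ⟨s, rfl⟩ := Ideal.mem_span_singleton.mp (ht ▸ h.symm.left_mem)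
  have h1 := h.coeff_left_x
  have h2 := h.coeff_left_y
  have h3 := h.coeff_right_y
  rw [hcoeff] at h1 h2 h3
  have hs : s ∈ maximalIdeal R := fun hunit => ((hunit.map φ).map constantCoeff).ne_zero
    ((mul_eq_zero_iff_left (left_ne_zero_of_mul_eq_one h1)).mp h2)
  rw [constantCoeff_eq_zero_of_mem_maximalIdeal ψ hs, mul_zero] at h3
  exact zero_ne_one h3

theorem not_isRegularLocalRing [IsNoetherianRing R] : ¬ IsRegularLocalRing R := by
  intro hreg
  have hle : (maximalIdeal R).spanFinrank ≤ 1 := by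
    exact_mod_cast hreg.spanFinrank_maximalIdeal.trans_le h.ringKrullDim_le_one
  refine h.not_isPrincipal ?_
  rcases Nat.le_one_iff_eq_zero_or_eq_one.mp hle with h0 | h1
  · rw [Submodule.spanFinrank_eq_zero_iff_eq_bot (IsNoetherian.noetherian _)] at h0
    exact h0 ▸ inferInstance
  · exact ((Submodule.spanFinrank_eq_one_iff _).mp h1).1

end IsNode

end LocalRing

/-! ### Taylor expansion and smooth arcs at a point of affine space -/

open MvPolynomial

section Taylor

variable {R S σ : Type*} [CommRing R] [CommRing S] [Algebra R S]

lemma aeval_add_sub_aeval_sub_sum_mem_sq [Fintype σ] {J : Ideal S} (y : σ → S) {h : σ → S}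
    (hh : ∀ j, h j ∈ J) (f : MvPolynomial σ R) :
    aeval (y + h) f - aeval y f - ∑ j, aeval y (pderiv j f) * h j ∈ J ^ 2 := by
  classical
  have hsum (f : MvPolynomial σ R) : ∑ j, aeval y (pderiv j f) * h j ∈ J :=
    J.sum_mem fun j _ => J.mul_mem_left _ (hh j)
  induction f using MvPolynomial.induction_on with
  | C r => simp
  | add f g hf hg =>
    convert (J ^ 2).add_mem hf hg using 1
    simp only [map_add, add_mul, Finset.sum_add_distrib]
    ring
  | mul_X f i hf =>
    have hmul := Ideal.mul_mem_mul (hsum f) (hh i)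
    rw [← pow_two] at hmul
    convert (J ^ 2).add_mem ((J ^ 2).mul_mem_right (y i + h i) hf) hmul using 1
    simp only [map_mul, aeval_X, Pi.add_apply, Derivation.leibniz, smul_eq_mul, map_add, add_mul,
      Finset.sum_add_distrib, pderiv_X, Pi.single_apply, apply_ite (aeval y), map_zero,
      mul_ite, mul_one, mul_zero, ite_mul, zero_mul, Finset.sum_ite_eq, Finset.mem_univ, if_true,
      mul_assoc, ← Finset.mul_sum]
    ring

lemma aeval_add_sub_aeval_mem {J : Ideal S} (y : σ → S) {h : σ → S} (hh : ∀ j, h j ∈ J)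
    (f : MvPolynomial σ R) : aeval (y + h) f - aeval y f ∈ J := by
  have hmod : (Ideal.Quotient.mkₐ R J).comp (aeval (y + h)) =
      (Ideal.Quotient.mkₐ R J).comp (aeval y) :=
    algHom_ext fun j => by simp [Ideal.Quotient.eq_zero_iff_mem.mpr (hh j)]
  exact Ideal.Quotient.eq.mp (DFunLike.congr_fun hmod f)

end Taylor

section Hensel

variable {R σ ι : Type*} [CommRing R] {I : Ideal R}
  {B : ι → MvPolynomial σ R} {W : Matrix σ ι R} {y : σ → R}

/-- The correction `-W B(y)` of Newton's method for the polynomial system `B = 0` at `y`, where `W`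
is an approximate right inverse of the Jacobian matrix. -/
def newtonCorrection [Fintype ι] (B : ι → MvPolynomial σ R) (W : Matrix σ ι R)
    (y : σ → R) : σ → R :=
  W.mulVec fun i => -eval y (B i)

lemma newtonCorrection_mem [Fintype ι] (hB : ∀ i, eval y (B i) ∈ I) (j : σ) :
    newtonCorrection B W y j ∈ I :=
  I.sum_mem fun i _ => I.mul_mem_left _ (I.neg_mem (hB i))

/-- The Newton iterates for the polynomial system `B = 0` starting at `y`, with the approximate
right inverse `W` of the Jacobian matrix kept fixed. -/
def newtonIterate [Fintype ι] (B : ι → MvPolynomial σ R) (W : Matrix σ ι R) (y : σ → R) (n : ℕ) :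
    σ → R :=
  (fun x => x + newtonCorrection B W x)^[n] y

lemma newtonIterate_succ [Fintype ι] (n : ℕ) : newtonIterate B W y (n + 1) =
    newtonIterate B W y n + newtonCorrection B W (newtonIterate B W y n) :=
  Function.iterate_succ_apply' _ _ _

variable [Fintype σ] [DecidableEq ι]

lemma eval_add_newtonCorrection_mem [Fintype ι] {n : ℕ} (hB : ∀ i, eval y (B i) ∈ I ^ (n + 1))
    (hW : ∀ i i', ∑ j, eval y (pderiv j (B i)) * W j i' - (1 : Matrix ι ι R) i i' ∈ I) (i : ι) :
    eval (y + newtonCorrection B W y) (B i) ∈ I ^ (n + 2) := by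
  have htaylor := aeval_add_sub_aeval_sub_sum_mem_sq y (newtonCorrection_mem (W := W) hB) (B i)
  simp only [aeval_eq_eval] at htaylor
  have hle : (I ^ (n + 1)) ^ 2 ≤ I ^ (n + 2) := by
    rw [← pow_mul]
    exact Ideal.pow_le_pow_right (by omega)
  have herr : ∑ i', (∑ j, eval y (pderiv j (B i)) * W j i' - (1 : Matrix ι ι R) i i') *
      -eval y (B i') ∈ I ^ (n + 2) := by
    refine Ideal.sum_mem _ fun i' _ => ?_
    rw [pow_succ' I (n + 1)]
    exact Ideal.mul_mem_mul (hW i i') (neg_mem (hB i'))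
  convert (I ^ (n + 2)).add_mem (hle htaylor) herr using 1
  simp only [sub_mul, Finset.sum_sub_distrib, Matrix.one_apply,
    ite_mul, one_mul, zero_mul, Finset.sum_ite_eq, Finset.mem_univ, if_true, newtonCorrection,
    Matrix.mulVec, dotProduct, Finset.mul_sum, Finset.sum_mul]
  rw [Finset.sum_comm]
  simp only [mul_assoc]
  ring

lemma newtonIterate_mem [Fintype ι] (hB : ∀ i, eval y (B i) ∈ I)
    (hW : ∀ i i', ∑ j, eval y (pderiv j (B i)) * W j i' - (1 : Matrix ι ι R) i i' ∈ I) (n : ℕ) :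
    (∀ j, newtonIterate B W y n j - y j ∈ I) ∧
      ∀ i, eval (newtonIterate B W y n) (B i) ∈ I ^ (n + 1) := by
  induction n with
  | zero => exact ⟨fun j => by simp [newtonIterate], fun i => by simpa [newtonIterate] using hB i⟩
  | succ n ih =>
    rw [newtonIterate_succ]
    refine ⟨fun j => ?_, fun i => eval_add_newtonCorrection_mem ih.2 (fun i i' => ?_) i⟩
    · rw [Pi.add_apply, add_sub_right_comm]
      exact I.add_mem (ih.1 j)
        (newtonCorrection_mem (fun i => Ideal.pow_le_self n.succ_ne_zero (ih.2 i)) j)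
    · have hsub : ∑ j, (eval (newtonIterate B W y n) (pderiv j (B i)) - eval y (pderiv j (B i))) *
          W j i' ∈ I := by
        refine I.sum_mem fun j _ => I.mul_mem_right _ ?_
        simpa [aeval_eq_eval] using
          aeval_add_sub_aeval_mem y (h := newtonIterate B W y n - y) ih.1 (pderiv j (B i))
      convert I.add_mem (hW i i') hsub using 1
      simp only [sub_mul, Finset.sum_sub_distrib]
      ring

/-- Multivariate Hensel's lemma: the Jacobian matrix is only required to have a right inverse modulo
`I`, so the system may have more unknowns than equations. -/
theorem exists_eval_eq_zero_of_jacobian [IsAdicComplete I R] [Finite ι]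
    (hB : ∀ i, eval y (B i) ∈ I)
    (hW : ∀ i i', ∑ j, eval y (pderiv j (B i)) * W j i' - (1 : Matrix ι ι R) i i' ∈ I) :
    ∃ z : σ → R, (∀ j, z j - y j ∈ I) ∧ ∀ i, eval z (B i) = 0 := by
  have := Fintype.ofFinite ι
  have hu := newtonIterate_mem hB hW
  have hcauchy (j : σ) : AdicCompletion.IsAdicCauchy I R fun n => newtonIterate B W y n j := by
    rw [AdicCompletion.isAdicCauchy_iff]
    intro n
    rw [SModEq.sub_mem, smul_eq_mul, Ideal.mul_top, newtonIterate_succ, Pi.add_apply,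
      sub_add_cancel_left]
    exact neg_mem (Ideal.pow_le_pow_right n.le_succ (newtonCorrection_mem (hu n).2 j))
  choose z hz using fun j => IsPrecomplete.prec (inferInstance : IsPrecomplete I R) (hcauchy j)
  have hzu (n : ℕ) (j : σ) : (z - newtonIterate B W y n) j ∈ I ^ n := by
    have := hz j n
    rwa [SModEq.comm, SModEq.sub_mem, smul_eq_mul, Ideal.mul_top] at this
  refine ⟨z, fun j => ?_, fun i => IsHausdorff.haus (I := I) inferInstance _ fun n => ?_⟩
  · have h1 := hzu 1 j
    rw [pow_one] at h1
    simpa using I.add_mem h1 ((hu 1).1 j)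
  · have hdiff := aeval_add_sub_aeval_mem (newtonIterate B W y n) (hzu n) (B i)
    rw [add_sub_cancel, aeval_eq_eval] at hdiff
    rw [SModEq.zero, smul_eq_mul, Ideal.mul_top]
    simpa using (I ^ n).add_mem hdiff (Ideal.pow_le_pow_right n.le_succ ((hu n).2 i))

end Hensel

section PowerSeries

variable {k σ ι : Type*} [Field k]

/-- The differential of a polynomial at the point `a`, as a linear form on the tangent space. -/
def differential [Fintype σ] (a : σ → k) : MvPolynomial σ k →ₗ[k] (σ → k) →ₗ[k] k :=
  ∑ j, ((aeval a).toLinearMap ∘ₗ (pderiv j).toLinearMap).smulRight (LinearMap.proj j)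

lemma differential_apply [Fintype σ] (a : σ → k) (f : MvPolynomial σ k) (w : σ → k) :
    differential a f w = ∑ j, eval a (pderiv j f) * w j := by
  simp [differential, LinearMap.sum_apply]

lemma differential_mul [Fintype σ] (a : σ → k) (f g : MvPolynomial σ k) :
    differential a (f * g) = eval a f • differential a g + eval a g • differential a f := by
  ext w
  simp [differential_apply, add_mul, Finset.sum_add_distrib, mul_assoc, Finset.mul_sum]

lemma surjective_pi_of_ker_le_span_singleton [Fintype σ] [Fintype ι]
    (hcard : Fintype.card σ = Fintype.card ι + 1) (D : (σ → k) →ₗ[k] ι → k) (Y : σ → k)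
    (hker : ∀ w, D w = 0 → w ∈ k ∙ Y) : Function.Surjective D := by
  have hle : Module.finrank k (LinearMap.ker D) ≤ 1 :=
    (Submodule.finrank_mono hker).trans (finrank_span_le_card {Y})
  have hsum := LinearMap.finrank_range_add_finrank_ker D
  rw [Module.finrank_fintype_fun_eq_card] at hsum
  refine LinearMap.range_eq_top.mp (Submodule.eq_top_of_finrank_eq ?_)
  have := Submodule.finrank_le (LinearMap.range D)
  rw [Module.finrank_fintype_fun_eq_card] at this ⊢
  omega

theorem exists_powerSeries_eval_eq_zero [Fintype σ] [Finite ι]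
    {B : ι → MvPolynomial σ (PowerSeries k)} {Y : σ → k}
    (hB : ∀ i, eval Y (map PowerSeries.constantCoeff (B i)) = 0)
    (hsurj : Function.Surjective
      (LinearMap.pi fun i => differential Y (map PowerSeries.constantCoeff (B i)))) :
    ∃ y : σ → PowerSeries k,
      (∀ j, PowerSeries.constantCoeff (y j) = Y j) ∧ ∀ i, eval y (B i) = 0 := by
  classical
  obtain ⟨g, hg⟩ := LinearMap.exists_rightInverse_of_surjective _ (LinearMap.range_eq_top.mpr hsurj)
  have hmem (f : PowerSeries k) :
      f ∈ Ideal.span {(PowerSeries.X : PowerSeries k)} ↔ PowerSeries.constantCoeff f = 0 := by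
    rw [Ideal.mem_span_singleton, PowerSeries.X_dvd_iff]
  have heval (f : MvPolynomial σ (PowerSeries k)) :
      PowerSeries.constantCoeff (eval (fun j => PowerSeries.C (Y j)) f) =
        eval Y (map PowerSeries.constantCoeff f) := by
    rw [map_eval]
    congr 2
  obtain ⟨z, hz, hzB⟩ := exists_eval_eq_zero_of_jacobian (B := B)
    (I := Ideal.span {(PowerSeries.X : PowerSeries k)}) (y := fun j => PowerSeries.C (Y j))
    (W := Matrix.of fun j i => PowerSeries.C (g (Pi.single i 1) j))
    (fun i => by rw [hmem, heval, hB]) fun i i' => by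
      have hgi := congrFun (LinearMap.congr_fun hg (Pi.single i' 1)) i
      rw [LinearMap.comp_apply, LinearMap.pi_apply, differential_apply, LinearMap.id_apply,
        Pi.single_apply] at hgi
      rw [hmem, map_sub, map_sum, Matrix.one_apply, apply_ite PowerSeries.constantCoeff, map_one,
        map_zero, ← hgi, sub_eq_zero]
      refine Finset.sum_congr rfl fun j _ => ?_
      rw [map_mul, heval, ← pderiv_map]
      simp
  refine ⟨z, fun j => ?_, hzB⟩
  simpa [hmem, sub_eq_zero] using hz j

end PowerSeries

section TaylorForm

variable {k σ : Type*} [Field k]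

/-- The expansion of `f` along the general line through `a`: the polynomial `f (a + t X)` in the
variable `t`, whose coefficients are the homogeneous components of `f` at `a`. -/
def lineExpansion (a : σ → k) : MvPolynomial σ k →ₐ[k] Polynomial (MvPolynomial σ k) :=
  aeval fun j => Polynomial.C (C (a j)) + Polynomial.X * Polynomial.C (X j)

/-- The homogeneous component of degree `n` of the Taylor expansion of `f` at `a`. -/
def taylorForm (a : σ → k) (n : ℕ) : MvPolynomial σ k →ₗ[k] MvPolynomial σ k :=
  (Polynomial.lcoeff (MvPolynomial σ k) n).restrictScalars k ∘ₗ (lineExpansion a).toLinearMap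

/-- The maximal ideal of the point `a` of affine space. -/
def maxIdeal (a : σ → k) : Ideal (MvPolynomial σ k) := RingHom.ker (eval a)

variable {a : σ → k} {f g : MvPolynomial σ k} {m n : ℕ}

lemma taylorForm_apply (a : σ → k) (n : ℕ) (f : MvPolynomial σ k) :
    taylorForm a n f = (lineExpansion a f).coeff n := rfl

lemma mem_maxIdeal : f ∈ maxIdeal a ↔ eval a f = 0 := Iff.rfl

lemma eval₂_lineExpansion {S : Type*} [CommRing S] [Algebra k S] (a : σ → k) (y : σ → S) (t : S)
    (f : MvPolynomial σ k) : (lineExpansion a f).eval₂ (aeval y : MvPolynomial σ k →ₐ[k] S) t =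
      aeval (fun j => algebraMap k S (a j) + t * y j) f := by
  induction f using MvPolynomial.induction_on with
  | C r => simp [lineExpansion]
  | add f g hf hg => rw [map_add, Polynomial.eval₂_add, hf, hg, map_add]
  | mul_X f j hf =>
    rw [map_mul, Polynomial.eval₂_mul, hf, map_mul]
    simp [lineExpansion, mul_comm t]

lemma taylorForm_zero (a : σ → k) (f : MvPolynomial σ k) : taylorForm a 0 f = C (eval a f) := by
  have h := eval₂_lineExpansion (S := MvPolynomial σ k) a X 0 f
  simp only [zero_mul, add_zero] at h
  rw [Polynomial.eval₂_at_zero] at h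
  refine .trans ?_ (h.trans (aeval_algebraMap_apply (MvPolynomial σ k) a f))
  simp [taylorForm_apply]

lemma pow_dvd_lineExpansion (hf : f ∈ maxIdeal a ^ n) : Polynomial.X ^ n ∣ lineExpansion a f := by
  have hle : maxIdeal a ≤ (Ideal.span {Polynomial.X}).comap (lineExpansion a) := fun g hg => by
    rw [Ideal.mem_comap, Ideal.mem_span_singleton, Polynomial.X_dvd_iff]
    exact (taylorForm_zero a g).trans (by rw [mem_maxIdeal.mp hg, map_zero])
  have := (Ideal.pow_right_mono hle n).trans (Ideal.le_comap_pow _ n) hf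
  rwa [Ideal.mem_comap, Ideal.span_singleton_pow, Ideal.mem_span_singleton] at this

lemma taylorForm_mul (hf : f ∈ maxIdeal a ^ m) (hg : g ∈ maxIdeal a ^ n) :
    taylorForm a (m + n) (f * g) = taylorForm a m f * taylorForm a n g := by
  obtain ⟨p, hp⟩ := pow_dvd_lineExpansion hf
  obtain ⟨q, hq⟩ := pow_dvd_lineExpansion hg
  rw [taylorForm_apply, taylorForm_apply, taylorForm_apply, map_mul, hp, hq, mul_mul_mul_comm,
    ← pow_add, Polynomial.coeff_X_pow_mul', Polynomial.coeff_X_pow_mul',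
    Polynomial.coeff_X_pow_mul']
  simp [Polynomial.mul_coeff_zero]

lemma eval_taylorForm_mul {w : σ → k} (h : ∀ i < n, eval w (taylorForm a i g) = 0) :
    eval w (taylorForm a n (f * g)) = eval a f * eval w (taylorForm a n g) := by
  rw [taylorForm_apply, map_mul, Polynomial.coeff_mul, map_sum,
    Finset.sum_eq_single_of_mem (0, n) (by simp)]
  · rw [← taylorForm_apply, ← taylorForm_apply, taylorForm_zero, map_mul, eval_C]
  · rintro ⟨i, j⟩ hij hne
    have hj : j < n := by
      have hsum : i + j = n := Finset.HasAntidiagonal.mem_antidiagonal.mp hij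
      grind
    rw [map_mul, ← taylorForm_apply, ← taylorForm_apply, h j hj, mul_zero]

lemma eval_taylorForm_eq_coeff [Infinite k] (w : σ → k) {p : Polynomial k}
    (hp : ∀ s : k, eval (a + s • w) f = p.eval s) : eval w (taylorForm a n f) = p.coeff n := by
  have hmap : (lineExpansion a f).map (eval w) = p := Polynomial.funext fun s => by
    rw [← hp, Polynomial.eval_map]
    exact eval₂_lineExpansion a w s f
  rw [taylorForm_apply, ← hmap, Polynomial.coeff_map]

lemma taylorForm_one [Fintype σ] (a : σ → k) (f : MvPolynomial σ k) :
    taylorForm a 1 f = ∑ j, C (eval a (pderiv j f)) * X j := by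
  have h := aeval_add_sub_aeval_sub_sum_mem_sq (J := Ideal.span {Polynomial.X})
    (fun j => algebraMap k (Polynomial (MvPolynomial σ k)) (a j))
    (h := fun j => Polynomial.X * Polynomial.C (X j))
    (fun j => Ideal.mul_mem_right _ _ (Ideal.mem_span_singleton_self _)) f
  rw [Ideal.span_singleton_pow, Ideal.mem_span_singleton, Polynomial.X_pow_dvd_iff] at h
  have hconst (g : MvPolynomial σ k) :
      aeval (fun j => Polynomial.C (C (a j) : MvPolynomial σ k)) g = Polynomial.C (C (eval a g)) :=
    aeval_algebraMap_apply (Polynomial (MvPolynomial σ k)) a g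
  rw [← sub_eq_zero]
  simpa [taylorForm_apply, lineExpansion, hconst, Pi.add_def, Polynomial.coeff_C,
    mul_comm Polynomial.X, ← mul_assoc] using h 1 one_lt_two

lemma eval_taylorForm_one [Fintype σ] (a w : σ → k) (f : MvPolynomial σ k) :
    eval w (taylorForm a 1 f) = differential a f w := by
  simp [taylorForm_one, differential_apply]

lemma differential_taylorForm_one [Fintype σ] (a y : σ → k) (f : MvPolynomial σ k) :
    differential y (taylorForm a 1 f) = differential a f := by
  classical
  ext w
  simp [taylorForm_one, differential_apply, pderiv_X, Pi.single_apply, apply_ite (eval y)]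

end TaylorForm

section Arc

variable {k σ ι : Type*} [Field k]

lemma constantCoeff_eval₂_X {R : Type*} [CommRing R] (g : R →+* PowerSeries k) (p : Polynomial R) :
    PowerSeries.constantCoeff (p.eval₂ g PowerSeries.X) =
      PowerSeries.constantCoeff (g (p.coeff 0)) := by
  rw [Polynomial.hom_eval₂, PowerSeries.constantCoeff_X, Polynomial.eval₂_at_zero]
  rfl

lemma constantCoeff_aeval {Y : σ → k} {z : σ → PowerSeries k}
    (hz : ∀ j, PowerSeries.constantCoeff (z j) = Y j) (f : MvPolynomial σ k) :
    PowerSeries.constantCoeff (aeval z f) = eval Y f := by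
  have : (PowerSeries.constantCoeff : PowerSeries k →+* k).comp (algebraMap k _) = RingHom.id k :=
    RingHom.ext fun c => PowerSeries.constantCoeff_C c
  rw [map_aeval, this, funext hz]
  rfl

variable [Fintype σ] {a : σ → k} {f : MvPolynomial σ k}
  {G : ι → MvPolynomial σ k}

lemma mem_sq_of_differential_eq_zero (hf : f ∈ maxIdeal a) (hdf : differential a f = 0) :
    f ∈ maxIdeal a ^ 2 := by
  classical
  have h := aeval_add_sub_aeval_sub_sum_mem_sq (J := maxIdeal a) (fun j => algebraMap k _ (a j))
    (h := fun j => X j - C (a j)) (fun j => by simp [mem_maxIdeal]) f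
  have hconst (g : MvPolynomial σ k) :
      aeval (fun j => algebraMap k (MvPolynomial σ k) (a j)) g = C (eval a g) :=
    aeval_algebraMap_apply _ a g
  have hX : (fun j => algebraMap k (MvPolynomial σ k) (a j)) + (fun j => X j - C (a j)) = X :=
    funext fun j => add_sub_cancel (C (a j)) (X j)
  have hpd (j : σ) : eval a (pderiv j f) = 0 := by
    simpa [differential_apply, Pi.single_apply] using LinearMap.congr_fun hdf (Pi.single j 1)
  simpa only [hX, aeval_X_left_apply, hconst, mem_maxIdeal.mp hf, hpd, map_zero, zero_mul,
    Finset.sum_const_zero, sub_zero] using h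

lemma mem_span_sup_sq [Finite ι] (hG : ∀ i, G i ∈ maxIdeal a) (hf : f ∈ maxIdeal a)
    (hker : ∀ w, (∀ i, differential a (G i) w = 0) → differential a f w = 0) :
    f ∈ Ideal.span (Set.range G) ⊔ maxIdeal a ^ 2 := by
  have := Fintype.ofFinite ι
  have hspan := mem_span_of_iInf_ker_le_ker (L := fun i => differential a (G i))
    (K := differential a f) fun w hw => hker w (by simpa using hw)
  obtain ⟨c, hc⟩ := (Submodule.mem_span_range_iff_exists_fun k).mp hspan
  have hsum : ∑ i, C (c i) * G i ∈ Ideal.span (Set.range G) :=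
    Ideal.sum_mem _ fun i _ => Ideal.mul_mem_left _ _ (Ideal.subset_span ⟨i, rfl⟩)
  have hle : Ideal.span (Set.range G) ≤ maxIdeal a :=
    Ideal.span_le.mpr (Set.range_subset_iff.mpr hG)
  have hdiff : differential a (f - ∑ i, C (c i) * G i) = 0 := by
    simp [hc, C_mul']
  rw [← add_sub_cancel (∑ i, C (c i) * G i) f]
  exact Submodule.add_mem_sup hsum
    (mem_sq_of_differential_eq_zero (sub_mem hf (hle hsum)) hdiff)

/-- `φ` is a formal arc through the point `a` with velocity `Y`. -/
structure IsArc (a Y : σ → k) (φ : MvPolynomial σ k →ₐ[k] PowerSeries k) : Prop where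
  constantCoeff_apply : ∀ f, PowerSeries.constantCoeff (φ f) = eval a f
  coeff_one_apply : ∀ f, PowerSeries.coeff 1 (φ f) = differential a f Y

lemma isArc_aeval {Y : σ → k} {z : σ → PowerSeries k}
    (hz : ∀ j, PowerSeries.constantCoeff (z j) = Y j) :
    IsArc a Y (aeval fun j => algebraMap k (PowerSeries k) (a j) + PowerSeries.X * z j) where
  constantCoeff_apply f := by
    rw [← eval₂_lineExpansion, constantCoeff_eval₂_X, RingHom.coe_coe, constantCoeff_aeval hz,
      ← taylorForm_apply, taylorForm_zero, eval_C]
  coeff_one_apply f := by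
    rw [← eval₂_lineExpansion, ← Polynomial.divX_mul_X_add (lineExpansion a f),
      Polynomial.eval₂_add, Polynomial.eval₂_mul_X, Polynomial.eval₂_C, map_add,
      PowerSeries.coeff_succ_mul_X, PowerSeries.coeff_zero_eq_constantCoeff_apply,
      constantCoeff_eval₂_X, Polynomial.coeff_divX, RingHom.coe_coe, constantCoeff_aeval hz,
      ← taylorForm_apply, ← taylorForm_apply, taylorForm_zero, eval_taylorForm_one]
    simp

theorem exists_isArc [Finite ι] {Y : σ → k} {r : ι → ℕ} (hG : ∀ i, G i ∈ maxIdeal a ^ r i)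
    (hY : ∀ i, eval Y (taylorForm a (r i) (G i)) = 0)
    (hsurj : Function.Surjective
      (LinearMap.pi fun i => differential Y (taylorForm a (r i) (G i)))) :
    ∃ φ, IsArc a Y φ ∧ ∀ i, φ (G i) = 0 := by
  choose Q hQ using fun i => pow_dvd_lineExpansion (hG i)
  have hform (i : ι) : taylorForm a (r i) (G i) = (Q i).coeff 0 := by
    simp [taylorForm_apply, hQ i, Polynomial.coeff_X_pow_mul']
  let ρ : Polynomial (MvPolynomial σ k) →+* MvPolynomial σ (PowerSeries k) :=
    Polynomial.eval₂RingHom (map PowerSeries.C) (C PowerSeries.X)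
  have hρ (q : Polynomial (MvPolynomial σ k)) :
      map PowerSeries.constantCoeff (ρ q) = q.coeff 0 := by
    induction q using Polynomial.induction_on' with
    | add p q hp hq => rw [map_add, map_add, hp, hq, Polynomial.coeff_add]
    | monomial n p =>
      rcases n with _ | n <;> simp [ρ, map_map, Polynomial.coeff_monomial, MvPolynomial.map_id]
  obtain ⟨z, hz, hzB⟩ := exists_powerSeries_eval_eq_zero (B := fun i => ρ (Q i)) (Y := Y)
    (fun i => by rw [hρ, ← hform, hY]) (by simpa only [hρ, ← hform] using hsurj)
  refine ⟨_, isArc_aeval hz, fun i => ?_⟩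
  have heval (q : Polynomial (MvPolynomial σ k)) :
      q.eval₂ (aeval z : MvPolynomial σ k →ₐ[k] PowerSeries k) PowerSeries.X = eval z (ρ q) := by
    simp [ρ, Polynomial.eval₂_eq_sum_range, map_sum, eval_map, aeval_def]
  rw [← eval₂_lineExpansion, hQ, heval, map_mul, map_mul, hzB, mul_zero]

end Arc

/-! ### Local rings of affine schemes at rational points -/

section ToLocal

lemma span_insert_add {A : Type*} [CommRing A] {s : Set A} {f g : A} (hf : f ∈ Ideal.span s) :
    Ideal.span (insert (f + g) s) = Ideal.span (insert g s) := by
  have hle {f g : A} (hf : f ∈ Ideal.span s) :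
      Ideal.span (insert (f + g) s) ≤ Ideal.span (insert g s) :=
    Ideal.span_le.mpr (Set.insert_subset (add_mem (Ideal.span_mono (Set.subset_insert _ _) hf)
      (Ideal.subset_span (Set.mem_insert _ _))) ((Set.subset_insert _ _).trans Ideal.subset_span))
  refine le_antisymm (hle hf) ?_
  simpa only [neg_add_cancel_left] using hle (g := f + g) (neg_mem hf)

lemma mul_sub_mul_mem_sup_pow_succ {A : Type*} [CommRing A] {J m : Ideal A} {p p' q q' : A} {n : ℕ}
    (hp : p - p' ∈ J ⊔ m ^ n) (hq : q - q' ∈ J ⊔ m ^ n) (hp' : p' ∈ m) (hqm : q ∈ m) :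
    p * q - p' * q' ∈ J ⊔ m ^ (n + 1) := by
  have hle : (J ⊔ m ^ n) * m ≤ J ⊔ m ^ (n + 1) := by
    rw [Ideal.sup_mul, ← pow_succ]
    exact sup_le_sup_right Ideal.mul_le_left _
  convert hle (add_mem (Ideal.mul_mem_mul hp hqm) (Ideal.mul_mem_mul hq hp')) using 1
  ring

open IsLocalRing

variable {A : Type*} [CommRing A] {I m : Ideal A} (P : Ideal (A ⧸ I)) [P.IsPrime] {f : A}

/-- The map from the coordinate ring of the ambient affine space to the local ring, at the point
`P`, of the subscheme defined by `I`. -/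
def toLocal : A →+* Localization.AtPrime P :=
  (algebraMap (A ⧸ I) (Localization.AtPrime P)).comp (Ideal.Quotient.mk I)

lemma toLocal_eq_zero_of_mem (hf : f ∈ I) : toLocal P f = 0 := by
  rw [toLocal, RingHom.comp_apply, Ideal.Quotient.eq_zero_iff_mem.mpr hf, map_zero]

variable {P} (hP : P.comap (Ideal.Quotient.mk I) = m)
include hP

lemma map_toLocal : m.map (toLocal P) = maximalIdeal (Localization.AtPrime P) := by
  rw [toLocal, ← Ideal.map_map, ← hP,
    Ideal.map_comap_of_surjective _ Ideal.Quotient.mk_surjective,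
    Localization.AtPrime.map_eq_maximalIdeal]

lemma toLocal_mem_maximalIdeal_pow {n : ℕ} (hf : f ∈ m ^ n) :
    toLocal P f ∈ maximalIdeal (Localization.AtPrime P) ^ n := by
  rw [← map_toLocal hP, ← Ideal.map_pow]
  exact Ideal.mem_map_of_mem _ hf

lemma maximalIdeal_eq_span_image [IsNoetherianRing A] {s : Set A} (hs : s ⊆ m)
    (hm : m ≤ Ideal.span s ⊔ I ⊔ m ^ 2) :
    maximalIdeal (Localization.AtPrime P) = Ideal.span (toLocal P '' s) := by
  have hbot : I.map (toLocal P) = ⊥ :=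
    le_bot_iff.mp (Ideal.map_le_iff_le_comap.mpr fun f hf => toLocal_eq_zero_of_mem P hf)
  have := IsLocalization.isNoetherianRing P.primeCompl (Localization.AtPrime P) inferInstance
  refine le_antisymm (le_of_le_sup_maximalIdeal_mul ?_) ?_
  · simpa only [Ideal.map_sup, Ideal.map_span, hbot, sup_bot_eq, Ideal.map_mul, map_toLocal hP,
      pow_two] using Ideal.map_mono (f := toLocal P) hm
  · rw [← Ideal.map_span, ← map_toLocal hP]
    exact Ideal.map_mono (Ideal.span_le.mpr hs)

end ToLocal

section LocalRingAtPoint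

open IsLocalRing

variable {k σ ι : Type*} [Field k] [Fintype σ] {a Y : σ → k} {I : Ideal (MvPolynomial σ k)}
  {P : Ideal (MvPolynomial σ k ⧸ I)} [P.IsPrime]

lemma IsArc.exists_localization {φ : MvPolynomial σ k →ₐ[k] PowerSeries k} (hφ : IsArc a Y φ)
    (hP : P.comap (Ideal.Quotient.mk I) = maxIdeal a)
    (hI : I ≤ RingHom.ker φ) : ∃ ψ : Localization.AtPrime P →+* PowerSeries k,
      IsLocalHom ψ ∧ ∀ f, ψ (toLocal P f) = φ f := by
  have hunit (f : P.primeCompl) :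
      IsUnit (Ideal.Quotient.lift I (φ : MvPolynomial σ k →+* PowerSeries k) hI f) := by
    obtain ⟨⟨f⟩, hf⟩ := f
    have hf' : f ∉ maxIdeal a := fun h => hf (hP.ge h)
    exact PowerSeries.isUnit_iff_constantCoeff.mpr
      (isUnit_iff_ne_zero.mpr ((hφ.constantCoeff_apply f).trans_ne hf'))
  let ψ : Localization.AtPrime P →+* PowerSeries k := IsLocalization.lift hunit
  have hψ (f : MvPolynomial σ k) : ψ (toLocal P f) = φ f := IsLocalization.lift_eq hunit _
  refine ⟨ψ, ⟨fun r hr => ?_⟩, hψ⟩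
  have hle : maximalIdeal (Localization.AtPrime P) ≤ (maximalIdeal (PowerSeries k)).comap ψ := by
    rw [← map_toLocal hP, Ideal.map_le_iff_le_comap]
    intro f hf
    rw [Ideal.mem_comap, Ideal.mem_comap, hψ, mem_maximalIdeal, mem_nonunits_iff,
      PowerSeries.isUnit_iff_constantCoeff, hφ.constantCoeff_apply, mem_maxIdeal.mp hf]
    exact not_isUnit_zero
  exact not_not.mp fun h => hle h hr

lemma exists_mem_maxIdeal_differential_eq (a : σ → k) (l : Module.Dual k (σ → k)) :
    ∃ x ∈ maxIdeal a, differential a x = l := by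
  classical
  refine ⟨∑ j, C (l (Pi.single j 1)) * (X j - C (a j)), by simp [mem_maxIdeal], ?_⟩
  refine LinearMap.pi_ext' fun j => LinearMap.ext_ring ?_
  simp [differential_apply, Pi.single_apply, pderiv_X, apply_ite (eval a)]

variable {G : ι → MvPolynomial σ k}

lemma exists_localParameters {κ : Type*} [Finite ι] [Fintype κ] [DecidableEq κ] {Y : κ → σ → k}
    (hY : LinearIndependent k Y) (hG : ∀ i, G i ∈ maxIdeal a)
    (hker : ∀ w, (∀ i, differential a (G i) w = 0) → w ∈ Submodule.span k (Set.range Y)) :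
    ∃ x : κ → MvPolynomial σ k, (∀ j, x j ∈ maxIdeal a) ∧
      (∀ i j, differential a (x i) (Y j) = if i = j then 1 else 0) ∧
      ∀ p ∈ maxIdeal a,
        p - ∑ j, C (differential a p (Y j)) * x j ∈ Ideal.span (Set.range G) ⊔ maxIdeal a ^ 2 := by
  obtain ⟨e, he⟩ := LinearMap.exists_leftInverse_of_injective (Fintype.linearCombination k Y)
    (LinearMap.ker_eq_bot.mpr (hY.fintypeLinearCombination_injective))
  choose x hx hxe using fun i => exists_mem_maxIdeal_differential_eq a (LinearMap.proj i ∘ₗ e)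
  have hdual (i j : κ) : differential a (x i) (Y j) = if i = j then 1 else 0 := by
    have := congrFun (LinearMap.congr_fun he (Pi.single j 1)) i
    simpa [hxe, Pi.single_apply] using this
  refine ⟨x, hx, hdual, fun p hp => mem_span_sup_sq hG
    (sub_mem hp (Ideal.sum_mem _ fun j _ => Ideal.mul_mem_left _ _ (hx j))) fun w hw => ?_⟩
  obtain ⟨c, rfl⟩ := (Submodule.mem_span_range_iff_exists_fun k).mp (hker w hw)
  simp only [C_mul', map_sub, map_sum, map_smul, LinearMap.sub_apply, LinearMap.sum_apply,
    LinearMap.smul_apply, hdual, smul_eq_mul, mul_ite, mul_one, mul_zero, Finset.sum_ite_eq',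
    Finset.mem_univ, if_true, sub_self, Finset.sum_const_zero]

lemma maxIdeal_le_span_sup {κ : Type*} [Fintype κ] {Y : κ → σ → k} {x : κ → MvPolynomial σ k}
    (hGI : Ideal.span (Set.range G) ≤ I)
    (hparam : ∀ p ∈ maxIdeal a,
      p - ∑ j, C (differential a p (Y j)) * x j ∈ Ideal.span (Set.range G) ⊔ maxIdeal a ^ 2) :
    maxIdeal a ≤ Ideal.span (Set.range x) ⊔ I ⊔ maxIdeal a ^ 2 := fun p hp => by
  rw [sup_assoc, ← add_sub_cancel (∑ j, C (differential a p (Y j)) * x j) p]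
  refine Submodule.add_mem_sup (Ideal.sum_mem _ fun j _ => ?_)
    (sup_le_sup_right hGI _ (hparam p hp))
  exact Ideal.mul_mem_left _ _ (Ideal.subset_span (Set.mem_range_self j))

theorem isReduced_and_isRegularLocalRing_of_differential [Fintype ι]
    (hcard : Fintype.card σ = Fintype.card ι + 1) (hI : I = Ideal.span (Set.range G))
    (hP : P.comap (Ideal.Quotient.mk I) = maxIdeal a) (hG : ∀ i, G i ∈ maxIdeal a) (hY : Y ≠ 0)
    (hker : ∀ w, (∀ i, differential a (G i) w = 0) ↔ w ∈ k ∙ Y) :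
    IsReduced (Localization.AtPrime P) ∧ IsRegularLocalRing (Localization.AtPrime P) := by
  have hGY : ∀ i, differential a (G i) Y = 0 := (hker Y).mpr (Submodule.mem_span_singleton_self Y)
  obtain ⟨φ, hφ, hφG⟩ := exists_isArc (r := fun _ => 1) (by simpa only [pow_one] using hG)
    (by simpa only [eval_taylorForm_one] using hGY)
    (surjective_pi_of_ker_le_span_singleton hcard _ Y fun w hw => (hker w).mp fun i => by
      simpa only [differential_taylorForm_one, LinearMap.pi_apply, Pi.zero_apply] using
        congrFun hw i)
  obtain ⟨x, hx, hdual, hparam⟩ := exists_localParameters (κ := Unit) (Y := fun _ => Y)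
    (linearIndependent_unique_iff.mpr hY) hG fun w hw => by simpa using (hker w).mp hw
  obtain ⟨ψ, -, hψ⟩ := hφ.exists_localization hP
    (hI ▸ Ideal.span_le.mpr (Set.range_subset_iff.mpr hφG))
  refine isReduced_and_isRegularLocalRing_of_maximalIdeal_eq_span_singleton
    (x := toLocal P (x ())) ?_ ψ fun h0 => ?_
  · rw [maximalIdeal_eq_span_image hP (Set.range_subset_iff.mpr hx)
      (maxIdeal_le_span_sup hI.ge hparam), ← Set.range_comp, Set.range_unique]
    rfl
  · have := hφ.coeff_one_apply (x ())
    rw [← hψ, h0, hdual () (), if_pos rfl] at this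
    exact zero_ne_one this

section Node

variable {g : MvPolynomial σ k} {Y₁ Y₂ : σ → k}

lemma exists_bilinForm_taylorForm_two {κ : Type*} [Fintype κ] {J : Ideal (MvPolynomial σ k)}
    {Y : κ → σ → k} {x : κ → MvPolynomial σ k} (hx : ∀ j, x j ∈ maxIdeal a)
    (hparam : ∀ p ∈ maxIdeal a,
      p - ∑ j, C (differential a p (Y j)) * x j ∈ J ⊔ maxIdeal a ^ 2)
    (hg : g ∈ maxIdeal a ^ 2) :
    ∃ B : LinearMap.BilinForm k (σ → k), (∀ y, eval y (taylorForm a 2 g) = B y y) ∧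
      (∀ y w, differential y (taylorForm a 2 g) w = B y w + B w y) ∧
      g - ∑ i, ∑ j, C (B (Y i) (Y j)) * (x i * x j) ∈ J ⊔ maxIdeal a ^ 3 := by
  rw [pow_two] at hg
  induction hg using Submodule.mul_induction_on' with
  | add f _ g _ hf hg =>
    obtain ⟨B, hB, hdB, hBx⟩ := hf
    obtain ⟨B', hB', hdB', hBx'⟩ := hg
    refine ⟨B + B', fun y => ?_, fun y w => ?_, ?_⟩
    · rw [map_add, map_add, hB, hB', LinearMap.add_apply, LinearMap.add_apply]
    · rw [map_add, map_add, LinearMap.add_apply, hdB, hdB']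
      simp only [LinearMap.add_apply]
      ring
    · convert add_mem hBx hBx' using 1
      simp only [LinearMap.add_apply, map_add, add_mul, Finset.sum_add_distrib]
      ring
  | mem_mul_mem p hp q hq =>
    have hT : taylorForm a 2 (p * q) = taylorForm a 1 p * taylorForm a 1 q :=
      taylorForm_mul (m := 1) (n := 1) (by simpa using hp) (by simpa using hq)
    refine ⟨LinearMap.BilinForm.linMulLin (differential a p) (differential a q), fun y => ?_,
      fun y w => ?_, ?_⟩
    · simp [hT, eval_taylorForm_one]
    · simp [hT, differential_mul, differential_taylorForm_one, eval_taylorForm_one]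
      ring
    · have hprod : ∑ i, ∑ j, C (differential a p (Y i) * differential a q (Y j)) * (x i * x j) =
          (∑ i, C (differential a p (Y i)) * x i) * ∑ j, C (differential a q (Y j)) * x j := by
        simp only [Finset.sum_mul_sum, map_mul, mul_mul_mul_comm]
      simp only [LinearMap.BilinForm.linMulLin_apply, hprod]
      exact mul_sub_mul_mem_sup_pow_succ (hparam p hp) (hparam q hq)
        (Ideal.sum_mem _ fun j _ => Ideal.mul_mem_left _ _ (hx j)) hq

lemma exists_isArc_of_taylorForm_two [Fintype ι] (hcard : Fintype.card σ = Fintype.card ι + 2)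
    (hG : ∀ i, G i ∈ maxIdeal a) (hg : g ∈ maxIdeal a ^ 2)
    (hker : ∀ w, (∀ i, differential a (G i) w = 0) ↔ w ∈ Submodule.span k {Y₁, Y₂})
    (h₁ : eval Y₁ (taylorForm a 2 g) = 0) (h₁₁ : differential Y₁ (taylorForm a 2 g) Y₁ = 0)
    (h₁₂ : differential Y₁ (taylorForm a 2 g) Y₂ ≠ 0) :
    ∃ φ, IsArc a Y₁ φ ∧ Ideal.span (insert g (Set.range G)) ≤ RingHom.ker φ := by
  have hGY : ∀ i, differential a (G i) Y₁ = 0 :=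
    (hker Y₁).mpr (Submodule.subset_span (Set.mem_insert _ _))
  suffices ∃ φ, IsArc a Y₁ φ ∧ ∀ i : Option ι, φ (i.elim g G) = 0 by
    obtain ⟨φ, hφ, hφG⟩ := this
    exact ⟨φ, hφ, Ideal.span_le.mpr (Set.insert_subset (hφG none)
      (Set.range_subset_iff.mpr fun i => hφG (some i)))⟩
  refine exists_isArc (r := fun i => i.elim 2 fun _ => 1) ?_ ?_ ?_
  · rintro (_ | i)
    exacts [hg, (pow_one (maxIdeal a)).symm ▸ hG i]
  · rintro (_ | i)
    exacts [h₁, (eval_taylorForm_one _ _ _).trans (hGY i)]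
  · refine surjective_pi_of_ker_le_span_singleton (by simp [hcard]) _ Y₁ fun w hw => ?_
    have hwG (i : ι) : differential a (G i) w = 0 :=
      (LinearMap.congr_fun (differential_taylorForm_one a Y₁ (G i)) w).symm.trans
        (congrFun hw (some i))
    obtain ⟨s, t, rfl⟩ := Submodule.mem_span_pair.mp ((hker w).mp hwG)
    have ht : differential Y₁ (taylorForm a 2 g) (s • Y₁ + t • Y₂) = 0 := congrFun hw none
    rw [map_add, map_smul, map_smul, h₁₁, smul_zero, zero_add, smul_eq_mul, mul_eq_zero,
      or_iff_left h₁₂] at ht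
    rw [ht, zero_smul, add_zero]
    exact Submodule.smul_mem _ _ (Submodule.mem_span_singleton_self _)

lemma IsArc.isNode {φ ψ : MvPolynomial σ k →ₐ[k] PowerSeries k} {x : Fin 2 → MvPolynomial σ k}
    (hP : P.comap (Ideal.Quotient.mk I) = maxIdeal a) (hφ : IsArc a Y₁ φ) (hψ : IsArc a Y₂ ψ)
    (hφI : I ≤ RingHom.ker φ) (hψI : I ≤ RingHom.ker ψ) (hx : ∀ j, x j ∈ maxIdeal a)
    (hdual : ∀ i j, differential a (x i) (![Y₁, Y₂] j) = if i = j then 1 else 0)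
    (hm : maxIdeal a ≤ Ideal.span (Set.range x) ⊔ I ⊔ maxIdeal a ^ 2)
    (hmul : x 0 * x 1 ∈ I ⊔ maxIdeal a ^ 3) :
    ∃ φ' ψ' : Localization.AtPrime P →+* PowerSeries k,
      IsNode (toLocal P (x 0)) (toLocal P (x 1)) φ' ψ' := by
  obtain ⟨φ', hφ', hφφ'⟩ := hφ.exists_localization hP hφI
  obtain ⟨ψ', hψ', hψψ'⟩ := hψ.exists_localization hP hψI
  refine ⟨φ', ψ', ?_, ?_, hφ', hψ', ?_, ?_, ?_, ?_⟩
  · rw [maximalIdeal_eq_span_image hP (Set.range_subset_iff.mpr hx) hm, ← Set.image_pair]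
    congr 2
    ext
    simp [Fin.exists_fin_two, eq_comm]
  · obtain ⟨f, hf, h, hh, hfh⟩ := Submodule.mem_sup.mp hmul
    rw [← map_mul, ← hfh, map_add, toLocal_eq_zero_of_mem P hf, zero_add]
    exact toLocal_mem_maximalIdeal_pow hP hh
  · rw [hφφ', hφ.coeff_one_apply]
    exact hdual 0 0
  · rw [hφφ', hφ.coeff_one_apply]
    exact hdual 1 0
  · rw [hψψ', hψ.coeff_one_apply]
    exact hdual 0 1
  · rw [hψψ', hψ.coeff_one_apply]
    exact hdual 1 1

lemma exists_isNode_of_mem_sq [Fintype ι] (hcard : Fintype.card σ = Fintype.card ι + 2)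
    (hI : I = Ideal.span (insert g (Set.range G)))
    (hP : P.comap (Ideal.Quotient.mk I) = maxIdeal a) (hG : ∀ i, G i ∈ maxIdeal a)
    (hg : g ∈ maxIdeal a ^ 2) (hY : LinearIndependent k ![Y₁, Y₂])
    (hker : ∀ w, (∀ i, differential a (G i) w = 0) ↔ w ∈ Submodule.span k {Y₁, Y₂})
    (h₁ : eval Y₁ (taylorForm a 2 g) = 0) (h₂ : eval Y₂ (taylorForm a 2 g) = 0)
    (h₁₂ : eval (Y₁ + Y₂) (taylorForm a 2 g) ≠ 0) :
    ∃ (x y : Localization.AtPrime P) (φ ψ : Localization.AtPrime P →+* PowerSeries k),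
      IsNode x y φ ψ := by
  have hGI : Ideal.span (Set.range G) ≤ I := hI ▸ Ideal.span_mono (Set.subset_insert _ _)
  have hgI : g ∈ I := hI ▸ Ideal.subset_span (Set.mem_insert _ _)
  obtain ⟨x, hx, hdual, hparam⟩ := exists_localParameters hY hG fun w hw => by
    simpa only [Matrix.range_cons, Matrix.range_empty, Set.union_empty, Set.singleton_union] using
      (hker w).mp hw
  obtain ⟨B, hB, hdB, hBx⟩ := exists_bilinForm_taylorForm_two hx hparam hg
  have hB₁ : B Y₁ Y₁ = 0 := (hB Y₁).symm.trans h₁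
  have hB₂ : B Y₂ Y₂ = 0 := (hB Y₂).symm.trans h₂
  have hB₁₂ : B Y₁ Y₂ + B Y₂ Y₁ ≠ 0 := by simpa [hB, hB₁, hB₂] using h₁₂
  have hxy : x 0 * x 1 ∈ I ⊔ maxIdeal a ^ 3 := by
    have hmul : C (B Y₁ Y₂ + B Y₂ Y₁) * (x 0 * x 1) ∈ I ⊔ maxIdeal a ^ 3 := by
      convert sub_mem (Ideal.mem_sup_left hgI) (sup_le_sup_right hGI _ hBx) using 1
      simp [Fin.sum_univ_two, hB₁, hB₂]
      ring
    refine (Ideal.unit_mul_mem_iff_mem _ ?_).mp hmul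
    exact (isUnit_iff_ne_zero.mpr hB₁₂).map C
  obtain ⟨φ, hφ, hφI⟩ := exists_isArc_of_taylorForm_two hcard hG hg hker h₁
    (by rw [hdB, hB₁, add_zero]) (by rwa [hdB])
  obtain ⟨ψ, hψ, hψI⟩ := exists_isArc_of_taylorForm_two hcard hG hg
    (fun w => Set.pair_comm Y₁ Y₂ ▸ hker w) h₂ (by rw [hdB, hB₂, add_zero])
    (by rwa [hdB, add_comm])
  exact ⟨_, _, hφ.isNode hP hψ (hI ▸ hφI) (hI ▸ hψI) hx hdual
    (maxIdeal_le_span_sup hGI hparam) hxy⟩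

lemma eval_taylorForm_two_eq_zero_of_mem_span [Finite ι] {w : σ → k} {f : MvPolynomial σ k}
    (hG : ∀ i, G i ∈ maxIdeal a) (h₁ : ∀ i, differential a (G i) w = 0)
    (h₂ : ∀ i, eval w (taylorForm a 2 (G i)) = 0) (hf : f ∈ Ideal.span (Set.range G)) :
    eval w (taylorForm a 2 f) = 0 := by
  cases nonempty_fintype ι
  obtain ⟨c, rfl⟩ := Ideal.mem_span_range_iff_exists_fun.mp hf
  rw [map_sum, map_sum]
  refine Finset.sum_eq_zero fun i _ => ?_
  rw [eval_taylorForm_mul fun n hn => ?_, h₂, mul_zero]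
  interval_cases n
  · rw [taylorForm_zero, mem_maxIdeal.mp (hG i), map_zero, map_zero]
  · rw [eval_taylorForm_one, h₁]

theorem exists_isNode [Fintype ι] (hcard : Fintype.card σ = Fintype.card ι + 2)
    (hI : I = Ideal.span (insert g (Set.range G)))
    (hP : P.comap (Ideal.Quotient.mk I) = maxIdeal a) (hG : ∀ i, G i ∈ maxIdeal a)
    (hg : g ∈ maxIdeal a) (hY : LinearIndependent k ![Y₁, Y₂])
    (hker : ∀ w, (∀ i, differential a (G i) w = 0) ↔ w ∈ Submodule.span k {Y₁, Y₂})
    (hdg : ∀ w ∈ Submodule.span k {Y₁, Y₂}, differential a g w = 0)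
    (hG₂ : ∀ w ∈ Submodule.span k {Y₁, Y₂}, ∀ i, eval w (taylorForm a 2 (G i)) = 0)
    (h₁ : eval Y₁ (taylorForm a 2 g) = 0) (h₂ : eval Y₂ (taylorForm a 2 g) = 0)
    (h₁₂ : eval (Y₁ + Y₂) (taylorForm a 2 g) ≠ 0) :
    ∃ (x y : Localization.AtPrime P) (φ ψ : Localization.AtPrime P →+* PowerSeries k),
      IsNode x y φ ψ := by
  obtain ⟨f, hf, g', hg', rfl⟩ := Submodule.mem_sup.mp
    (mem_span_sup_sq hG hg fun w hw => hdg w ((hker w).mp hw))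
  have heval (w : σ → k) (hw : w ∈ Submodule.span k {Y₁, Y₂}) :
      eval w (taylorForm a 2 (f + g')) = eval w (taylorForm a 2 g') := by
    rw [map_add, map_add,
      eval_taylorForm_two_eq_zero_of_mem_span hG ((hker w).mpr hw) (hG₂ w hw) hf, zero_add]
  have hY₁ : Y₁ ∈ Submodule.span k {Y₁, Y₂} := Submodule.subset_span (Set.mem_insert _ _)
  have hY₂ : Y₂ ∈ Submodule.span k {Y₁, Y₂} :=
    Submodule.subset_span (Set.mem_insert_of_mem _ rfl)
  rw [heval _ hY₁] at h₁
  rw [heval _ hY₂] at h₂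
  rw [heval _ (add_mem hY₁ hY₂)] at h₁₂
  refine exists_isNode_of_mem_sq hcard (hI.trans (span_insert_add hf)) hP hG hg' hY hker h₁ h₂ h₁₂

end Node

end LocalRingAtPoint

/-! ### Polarization and smooth cubics -/

section Polarization

variable {σ K : Type*} [Field K]

lemma pderiv_pderiv_comm (i j : σ) (p : MvPolynomial σ K) :
    pderiv i (pderiv j p) = pderiv j (pderiv i p) := by
  classical
  have h : ⁅pderiv (R := K) i, pderiv (R := K) j⁆ = 0 := derivation_ext fun k => by
    rw [Derivation.commutator_apply, pderiv_X, pderiv_X, Pi.single_apply, Pi.single_apply]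
    split_ifs <;> simp
  have h' := congrArg (fun D : Derivation K (MvPolynomial σ K) (MvPolynomial σ K) => D p) h
  simp only [Derivation.commutator_apply, Derivation.coe_zero, Pi.zero_apply] at h'
  exact sub_eq_zero.mp h'

variable {F : MvPolynomial σ K}

lemma eval_eq_eval_zero (hF : F.IsHomogeneous 0) (x : σ → K) : eval x F = eval 0 F := by
  rw [totalDegree_eq_zero_iff_eq_C.mp ((totalDegree_zero_iff_isHomogeneous _).mpr hF), eval_C,
    eval_C]

variable [Fintype σ]

/-- The polarization of a cubic form `F`: the symmetric trilinear form with
`polar F x x x = F x`. -/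
def polar (F : MvPolynomial σ K) : (σ → K) →ₗ[K] (σ → K) →ₗ[K] (σ → K) →ₗ[K] K :=
  ∑ i, ∑ j, ∑ k, (6⁻¹ * eval 0 (pderiv i (pderiv j (pderiv k F)))) •
    (LinearMap.proj i : (σ → K) →ₗ[K] K).smulRight
      ((LinearMap.proj j : (σ → K) →ₗ[K] K).smulRight (LinearMap.proj k : (σ → K) →ₗ[K] K))

lemma polar_apply (x y z : σ → K) : polar F x y z =
    ∑ i, ∑ j, ∑ k, 6⁻¹ * eval 0 (pderiv i (pderiv j (pderiv k F))) * (x i * (y j * z k)) := by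
  simp only [polar, LinearMap.sum_apply, LinearMap.smul_apply, LinearMap.smulRight_apply,
    LinearMap.proj_apply, smul_eq_mul]

lemma polar_swap (x y z : σ → K) : polar F x y z = polar F y x z := by
  rw [polar_apply, polar_apply, Finset.sum_comm]
  refine Finset.sum_congr rfl fun i _ => Finset.sum_congr rfl fun j _ =>
    Finset.sum_congr rfl fun k _ => ?_
  rw [pderiv_pderiv_comm]
  ring

lemma polar_swap_right (x y z : σ → K) : polar F x y z = polar F x z y := by
  rw [polar_apply, polar_apply]
  refine Finset.sum_congr rfl fun i _ => ?_
  rw [Finset.sum_comm]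
  refine Finset.sum_congr rfl fun j _ => Finset.sum_congr rfl fun k _ => ?_
  rw [pderiv_pderiv_comm k j]
  ring

lemma polar_rotate (x y z : σ → K) : polar F x y z = polar F y z x := by
  rw [polar_swap, polar_swap_right]

lemma sum_mul_apply_single [DecidableEq σ] (l : (σ → K) →ₗ[K] K) (x : σ → K) :
    ∑ i, x i * l (Pi.single i 1) = l x := by
  conv_rhs => rw [pi_eq_sum_univ' x]
  simp [map_sum]

lemma sum_mul_eval_pderiv {n : ℕ} (hF : F.IsHomogeneous n) (x : σ → K) :
    ∑ i, x i * eval x (pderiv i F) = n * eval x F := by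
  simpa using congrArg (eval x) hF.sum_X_mul_pderiv

variable [CharZero K] (hF : F.IsHomogeneous 3)
include hF

lemma eval_pderiv_pderiv [DecidableEq σ] (x : σ → K) (j k : σ) :
    eval x (pderiv j (pderiv k F)) = 6 * polar F x (Pi.single j 1) (Pi.single k 1) := by
  have h := sum_mul_eval_pderiv (hF.pderiv (i := k).pderiv (i := j)) x
  rw [Nat.cast_one, one_mul] at h
  rw [← h, polar_apply, Finset.mul_sum]
  refine Finset.sum_congr rfl fun i _ => ?_
  rw [eval_eq_eval_zero (hF.pderiv.pderiv.pderiv) x]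
  simp [Pi.single_apply]
  ring

lemma eval_pderiv [DecidableEq σ] (x : σ → K) (k : σ) :
    eval x (pderiv k F) = 3 * polar F x x (Pi.single k 1) := by
  have h := sum_mul_eval_pderiv (hF.pderiv (i := k)) x
  simp only [eval_pderiv_pderiv hF, mul_left_comm _ (6 : K), ← Finset.mul_sum] at h
  have hsum := sum_mul_apply_single ((polar F x).flip (Pi.single k 1)) x
  simp only [LinearMap.flip_apply] at hsum
  rw [hsum] at h
  push_cast at h
  linear_combination -h / 2

lemma eval_eq_polar (x : σ → K) : eval x F = polar F x x x := by
  classical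
  have h := sum_mul_eval_pderiv hF x
  simp only [eval_pderiv hF, mul_left_comm _ (3 : K), ← Finset.mul_sum,
    sum_mul_apply_single] at h
  exact (mul_left_cancel₀ three_ne_zero h).symm

omit [CharZero K] hF in
lemma polar_add_smul_self (x n : σ → K) (z : K) : polar F (x + z • n) (x + z • n) (x + z • n) =
    polar F x x x + 3 * z * polar F x x n + 3 * z ^ 2 * polar F x n n + z ^ 3 * polar F n n n := by
  simp only [map_add, LinearMap.add_apply, map_smul, LinearMap.smul_apply, smul_eq_mul]
  rw [polar_rotate n x x, polar_swap_right x n x, polar_swap n x n, polar_rotate n n x,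
    polar_swap n x n]
  ring

-- The three index vectors list, for each `i`, the multiset of `3 - i` zeros and `i` ones.
lemma eval_combination (v : Fin 2 → σ → K) (p q : K) : eval (p • v 0 + q • v 1) F =
    ∑ i : Fin 4, ![1, 3, 3, 1] i * polar F (v (![0, 0, 0, 1] i)) (v (![0, 0, 1, 1] i))
      (v (![0, 1, 1, 1] i)) * (p ^ (3 - (i : ℕ)) * q ^ (i : ℕ)) := by
  rw [eval_eq_polar hF, polar_add_smul_self, Fin.sum_univ_four]
  simp only [map_smul, LinearMap.smul_apply, smul_eq_mul]
  simp
  ring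

variable {U : Submodule K (σ → K)}

omit hF in
lemma polar_eq_zero_of_forall_polar_self {n : σ → K} (h : ∀ x ∈ U, polar F x x n = 0)
    {x y : σ → K} (hx : x ∈ U) (hy : y ∈ U) : polar F x y n = 0 := by
  have hxy := h _ (U.add_mem hx hy)
  simp only [map_add, LinearMap.add_apply, h x hx, h y hy, polar_swap y x] at hxy
  linear_combination hxy / 2

lemma polar_eq_zero_of_forall_eval (h : ∀ x ∈ U, eval x F = 0) {x y z : σ → K} (hx : x ∈ U)
    (hy : y ∈ U) (hz : z ∈ U) : polar F x y z = 0 := by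
  refine polar_eq_zero_of_forall_polar_self (fun w hw => ?_) hx hy
  have hcube : ∀ v ∈ U, polar F v v v = 0 := fun v hv => by rw [← eval_eq_polar hF, h v hv]
  have h₁ := hcube _ (U.add_mem hw (U.smul_mem 1 hz))
  have h₂ := hcube _ (U.add_mem hw (U.smul_mem (-1) hz))
  rw [polar_add_smul_self] at h₁ h₂
  linear_combination (h₁ - h₂ - 2 * hcube z hz) / 6

end Polarization

section PencilOfQuadrics

variable {K V : Type*} [Field K] [IsAlgClosed K] [NeZero (2 : K)] [AddCommGroup V] [Module K V]

lemma exists_binary_quadratic_eq_zero (a b c : K) :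
    ∃ p q : K, (p ≠ 0 ∨ q ≠ 0) ∧ a * p ^ 2 + b * (p * q) + c * q ^ 2 = 0 := by
  by_cases ha : a = 0
  · exact ⟨1, 0, Or.inl one_ne_zero, by simp [ha]⟩
  · obtain ⟨p, hp⟩ := exists_quadratic_eq_zero ha (IsAlgClosed.exists_eq_mul_self (discrim a b c))
    exact ⟨p, 1, Or.inr one_ne_zero, by linear_combination hp⟩

lemma exists_isotropic (hV : 2 ≤ Module.finrank K V) (B : LinearMap.BilinForm K V) :
    ∃ x ≠ 0, B x x = 0 := by
  have : Nontrivial V := Module.nontrivial_of_finrank_pos (R := K) (by omega)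
  obtain ⟨z, hz⟩ := exists_ne (0 : V)
  obtain ⟨w, hzw⟩ := exists_linearIndependent_pair_of_one_lt_finrank (R := K) (by omega) hz
  obtain ⟨p, q, hpq, h⟩ := exists_binary_quadratic_eq_zero (B z z) (B z w + B w z) (B w w)
  refine ⟨p • z + q • w, fun h0 => ?_, ?_⟩
  · obtain ⟨rfl, rfl⟩ := LinearIndependent.pair_iff.mp hzw p q h0
    simp at hpq
  · simp only [map_add, LinearMap.add_apply, map_smul, LinearMap.smul_apply, smul_eq_mul]
    linear_combination h

variable [FiniteDimensional K V]

lemma exists_common_isotropic_of_apply_eq_zero (hV : 3 ≤ Module.finrank K V)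
    {B₁ : LinearMap.BilinForm K V} (h₁ : B₁.IsSymm) (B₂ : LinearMap.BilinForm K V) {z : V}
    (hz : z ≠ 0) (hB₁ : B₁ z = 0) : ∃ x ≠ 0, B₁ x x = 0 ∧ B₂ x x = 0 := by
  obtain ⟨W, hW⟩ := (K ∙ z).exists_isCompl
  have hfinrank := Submodule.finrank_add_eq_of_isCompl hW
  rw [finrank_span_singleton hz] at hfinrank
  obtain ⟨⟨w, hwW⟩, hw0, hw⟩ := exists_isotropic (by omega) (B₁.restrict W)
  have hzw : LinearIndependent K ![z, w] := (LinearIndependent.pair_iff' hz).mpr fun s hs =>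
    hw0 (Subtype.ext ((Submodule.disjoint_def.mp hW.disjoint) w
      (Submodule.mem_span_singleton.mpr ⟨s, hs⟩) hwW))
  obtain ⟨⟨x, hxU⟩, hx0, hx⟩ := exists_isotropic (finrank_span_eq_card hzw).ge
    (B₂.restrict (Submodule.span K (Set.range ![z, w])))
  refine ⟨x, fun h => hx0 (Subtype.ext h), ?_, hx⟩
  rw [Matrix.range_cons_cons_empty, Submodule.mem_span_pair] at hxU
  obtain ⟨p, q, rfl⟩ := hxU
  have hwz : B₁ w z = 0 := by rw [← h₁.eq, hB₁]; rfl
  have hww : B₁ w w = 0 := hw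
  simp [hB₁, hwz, hww]

omit [NeZero (2 : K)] in
lemma exists_apply_eq_smul_apply [Nontrivial V] (B₁ B₂ : LinearMap.BilinForm K V) :
    ∃ z ≠ 0, B₂ z = 0 ∨ ∃ μ : K, B₁ z = μ • B₂ z := by
  by_cases hB : Function.Injective B₂
  · let f := LinearMap.linearEquivOfInjective B₂ hB Subspace.dual_finrank_eq.symm
    obtain ⟨μ, hμ⟩ := Module.End.exists_eigenvalue (f.symm.toLinearMap ∘ₗ B₁)
    obtain ⟨z, hz⟩ := hμ.exists_hasEigenvector
    refine ⟨z, hz.2, Or.inr ⟨μ, ?_⟩⟩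
    have h : f.symm (B₁ z) = μ • z := hz.apply_eq_smul
    rw [LinearEquiv.symm_apply_eq, map_smul] at h
    exact h
  · rw [injective_iff_map_eq_zero] at hB
    push Not at hB
    obtain ⟨z, hz, hz0⟩ := hB
    exact ⟨z, hz0, Or.inl hz⟩

-- Some member of the pencil spanned by `B₁` and `B₂` is degenerate.
lemma exists_common_isotropic (hV : 3 ≤ Module.finrank K V) {B₁ B₂ : LinearMap.BilinForm K V}
    (h₁ : B₁.IsSymm) (h₂ : B₂.IsSymm) : ∃ x ≠ 0, B₁ x x = 0 ∧ B₂ x x = 0 := by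
  have : Nontrivial V := Module.nontrivial_of_finrank_pos (R := K) (by omega)
  obtain ⟨z, hz, h | ⟨μ, h⟩⟩ := exists_apply_eq_smul_apply B₁ B₂
  · obtain ⟨x, hx, hx₂, hx₁⟩ := exists_common_isotropic_of_apply_eq_zero hV h₂ B₁ hz h
    exact ⟨x, hx, hx₁, hx₂⟩
  · obtain ⟨x, hx, hx₁, hx₂⟩ := exists_common_isotropic_of_apply_eq_zero hV
      (h₁.sub (h₂.smul μ)) B₂ hz (sub_eq_zero.mpr h)
    refine ⟨x, hx, ?_, hx₂⟩
    simpa [hx₂] using hx₁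

end PencilOfQuadrics

section Smooth

variable {F : MvPolynomial (Fin 5) ℂ} (hF : F.IsHomogeneous 3) (hX : IsSmooth F)
include hF hX

lemma eq_zero_of_forall_polar_eq_zero {x : Fin 5 → ℂ} (h : ∀ y, polar F x x y = 0) : x = 0 := by
  by_contra hx
  obtain ⟨i, hi⟩ := hX x hx (by rw [eval_eq_polar hF, h])
  exact hi (by rw [eval_pderiv hF, h, mul_zero])

-- If `F` vanished on `P`, its derivatives in two directions transverse to `P` would be two conics
-- on `P`, and a common zero of them would be a singular point of the cubic.
lemma exists_mem_eval_ne_zero {P : Submodule ℂ (Fin 5 → ℂ)} (hP : Module.finrank ℂ P = 3) :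
    ∃ x ∈ P, eval x F ≠ 0 := by
  by_contra! h
  obtain ⟨W, hW⟩ := P.exists_isCompl
  have hW2 : Module.finrank ℂ W = 2 := by
    have := Submodule.finrank_add_eq_of_isCompl hW
    rw [hP, Module.finrank_fin_fun] at this
    omega
  let b := Module.finBasisOfFinrankEq ℂ W hW2
  let B (i : Fin 2) : LinearMap.BilinForm ℂ P :=
    ((polar F).compr₂ (LinearMap.applyₗ (b i : Fin 5 → ℂ))).domRestrict₁₂ P P
  have hB : ∀ i, (B i).IsSymm := fun i => ⟨fun x y => polar_swap (x : Fin 5 → ℂ) y (b i)⟩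
  obtain ⟨x, hx, h₀, h₁⟩ := exists_common_isotropic hP.ge (hB 0) (hB 1)
  have hW0 : ∀ w ∈ W, polar F x x w = 0 := fun w hw => by
    rw [show w = (⟨w, hw⟩ : W) from rfl, ← b.sum_repr ⟨w, hw⟩, Fin.sum_univ_two]
    have h₀' : polar F x x (b 0) = 0 := h₀
    have h₁' : polar F x x (b 1) = 0 := h₁
    simp [h₀', h₁']
  refine hx (Subtype.ext (eq_zero_of_forall_polar_eq_zero hF hX fun y => ?_))
  obtain ⟨y, hy, w, hw, rfl⟩ := Submodule.mem_sup.mp (hW.sup_eq_top ▸ Submodule.mem_top : y ∈ P ⊔ W)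
  rw [map_add, polar_eq_zero_of_forall_eval hF h x.2 x.2 hy, hW0 w hw, add_zero]

end Smooth

/-! ### Planes tangent to a cubic along a line -/

section LinearAlgebra

variable {K V : Type*} [Field K] [AddCommGroup V] [Module K V] {L P : Submodule K V} {x y n : V}

lemma finrank_sup_span_singleton [FiniteDimensional K V] (hn : n ∉ L) :
    Module.finrank K (L ⊔ K ∙ n : Submodule K V) = Module.finrank K L + 1 := by
  have h := Submodule.finrank_sup_add_finrank_inf_eq L (K ∙ n)
  have hdisj : L ⊓ K ∙ n = ⊥ := (Submodule.disjoint_span_singleton_of_notMem hn).eq_bot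
  rwa [hdisj, finrank_bot, finrank_span_singleton (by rintro rfl; exact hn L.zero_mem)] at h

lemma finrank_inf_ker_add_one [FiniteDimensional K V] (l : Module.Dual K V) (hx : x ∈ P)
    (hlx : l x ≠ 0) : Module.finrank K (P ⊓ LinearMap.ker l : Submodule K V) + 1 =
      Module.finrank K P := by
  rw [← Module.Dual.finrank_ker_add_one_of_ne_zero (f := l.domRestrict P)
    fun h => hlx (LinearMap.congr_fun h ⟨x, hx⟩), add_left_inj, ← Submodule.map_comap_subtype]
  exact Submodule.finrank_map_subtype_eq P _

lemma exists_dual_eq_zero_of_notMem (hn : n ∉ L) :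
    ∃ l : Module.Dual K V, (∀ x ∈ L, l x = 0) ∧ l n = 1 := by
  obtain ⟨l, hln, hl⟩ := Submodule.exists_le_ker_of_notMem hn
  exact ⟨(l n)⁻¹ • l, fun x hx => by simp [LinearMap.mem_ker.mp (hl hx)], by simp [hln]⟩

lemma sup_span_singleton_inf_ker {l : Module.Dual K V} (hl : ∀ x ∈ L, l x = 0) (hln : l n ≠ 0) :
    (L ⊔ K ∙ n) ⊓ LinearMap.ker l = L := by
  rw [sup_inf_assoc_of_le _ (show L ≤ LinearMap.ker l from hl), sup_eq_left]
  rintro x ⟨hx, hlx⟩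
  obtain ⟨z, rfl⟩ := Submodule.mem_span_singleton.mp hx
  have hz : z = 0 := by simpa [hln] using hlx
  simp [hz]

lemma mem_sup_span_singleton : y ∈ L ⊔ K ∙ n ↔ ∃ x ∈ L, ∃ z : K, x + z • n = y := by
  simp [Submodule.mem_sup, Submodule.mem_span_singleton]

end LinearAlgebra

section PlaneSection

variable {F : MvPolynomial (Fin 5) ℂ} {P L L' : Submodule ℂ (Fin 5 → ℂ)} {n : Fin 5 → ℂ}

/-- The plane spanned by the line `L` of `F = 0` and the point `n` outside `L` is tangent to the
cubic `F = 0` along `L`. -/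
structure IsTangentAlong (F : MvPolynomial (Fin 5) ℂ) (L : Submodule ℂ (Fin 5 → ℂ))
    (n : Fin 5 → ℂ) : Prop where
  notMem : n ∉ L
  eval_eq_zero : ∀ x ∈ L, eval x F = 0
  polar_eq_zero : ∀ x ∈ L, polar F x x n = 0

lemma PlaneSection.le (h : PlaneSection F P L L') : L ≤ P := by
  obtain ⟨-, -, -, l, m, hL, -⟩ := h
  exact hL ▸ inf_le_left

lemma PlaneSection.eq_sup (h : PlaneSection F P L L') (hnP : n ∈ P) (hn : n ∉ L) :
    P = L ⊔ ℂ ∙ n := by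
  refine (Submodule.eq_of_le_of_finrank_eq
    (sup_le h.le ((Submodule.span_singleton_le_iff_mem n P).mpr hnP)) ?_).symm
  rw [finrank_sup_span_singleton hn, h.1, h.2.1]

lemma eval_add_smul_eq_polar (hF : F.IsHomogeneous 3) (x : Fin 5 → ℂ) (z : ℂ) : eval (x + z • n) F =
    eval x F + 3 * z * polar F x x n + 3 * z ^ 2 * polar F x n n + z ^ 3 * eval n F := by
  rw [eval_eq_polar hF, polar_add_smul_self, eval_eq_polar hF, eval_eq_polar hF]

lemma PlaneSection.isTangentAlong (hF : F.IsHomogeneous 3) (h : PlaneSection F P L L')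
    (hnP : n ∈ P) (hn : n ∉ L) : IsTangentAlong F L n ∧ (L' = L → ∀ x ∈ L, polar F x n n = 0) := by
  have hLP := h.le
  obtain ⟨-, -, -, l, m, hL, hL', heval⟩ := h
  have hl : ∀ x ∈ L, l x = 0 := fun x hx => (hL ▸ hx : x ∈ P ⊓ LinearMap.ker l).2
  have hexpand : ∀ x ∈ L, ∀ z : ℂ, eval x F + 3 * z * polar F x x n + 3 * z ^ 2 * polar F x n n +
      z ^ 3 * eval n F = z ^ 2 * l n ^ 2 * (m x + z * m n) := fun x hx z => by
    rw [← eval_add_smul_eq_polar hF, heval _ (P.add_mem (hLP hx) (P.smul_mem z hnP)), map_add,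
      map_smul, hl x hx, map_add, map_smul, smul_eq_mul, smul_eq_mul]
    ring
  refine ⟨⟨hn, fun x hx => ?_, fun x hx => ?_⟩, fun hLL' x hx => ?_⟩
  · linear_combination hexpand x hx 0
  · linear_combination -hexpand x hx 0 / 6 + hexpand x hx 1 / 3 - hexpand x hx (-1) / 9
      - hexpand x hx 2 / 18
  · have hm : m x = 0 := (hL' ▸ hLL' ▸ hx : x ∈ P ⊓ LinearMap.ker m).2
    linear_combination (-hexpand x hx 0 + hexpand x hx 1 / 2 + hexpand x hx (-1) / 2
      + l n ^ 2 * hm) / 3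

lemma IsTangentAlong.eval_add_smul (hF : F.IsHomogeneous 3) (h : IsTangentAlong F L n)
    {x : Fin 5 → ℂ} (hx : x ∈ L) (z : ℂ) :
    eval (x + z • n) F = 3 * z ^ 2 * polar F x n n + z ^ 3 * eval n F := by
  rw [eval_add_smul_eq_polar hF, h.eval_eq_zero x hx, h.polar_eq_zero x hx]
  ring

variable (hF : F.IsHomogeneous 3) (hX : IsSmooth F) (hL : Module.finrank ℂ L = 2)
include hF hX hL

lemma IsTangentAlong.exists_planeSection (h : IsTangentAlong F L n) :
    ∃ L', PlaneSection F (L ⊔ ℂ ∙ n) L L' := by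
  have hP : Module.finrank ℂ (L ⊔ ℂ ∙ n : Submodule ℂ (Fin 5 → ℂ)) = 3 := by
    rw [finrank_sup_span_singleton h.notMem, hL]
  obtain ⟨l, hl, hln⟩ := exists_dual_eq_zero_of_notMem h.notMem
  let m : Module.Dual ℂ (Fin 5 → ℂ) := (3 : ℂ) • polar F n n - (2 * eval n F) • l
  have heval : ∀ y ∈ L ⊔ ℂ ∙ n, eval y F = l y ^ 2 * m y := fun y hy => by
    obtain ⟨x, hx, z, rfl⟩ := mem_sup_span_singleton.mp hy
    have hm : m (x + z • n) = 3 * polar F x n n + z * eval n F := by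
      simp only [m, LinearMap.sub_apply, map_add, map_smul, LinearMap.smul_apply, smul_eq_mul,
        hl x hx, hln, polar_rotate x n n, ← eval_eq_polar hF]
      ring
    rw [h.eval_add_smul hF hx, hm, map_add, map_smul, hl x hx, hln, smul_eq_mul]
    ring
  obtain ⟨x, hxP, hx⟩ := exists_mem_eval_ne_zero hF hX hP
  have hmx : m x ≠ 0 := right_ne_zero_of_mul (heval x hxP ▸ hx)
  have hL' := finrank_inf_ker_add_one m hxP hmx
  exact ⟨(L ⊔ ℂ ∙ n) ⊓ LinearMap.ker m, hP, hL, by omega, l, m,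
    sup_span_singleton_inf_ker hl (hln ▸ one_ne_zero), rfl, heval⟩

lemma IsTangentAlong.eval_ne_zero (h : IsTangentAlong F L n) (h₃ : ∀ x ∈ L, polar F x n n = 0) :
    eval n F ≠ 0 := by
  obtain ⟨y, hy, hyF⟩ := exists_mem_eval_ne_zero hF hX
    (P := L ⊔ ℂ ∙ n) (by rw [finrank_sup_span_singleton h.notMem, hL])
  obtain ⟨x, hx, z, rfl⟩ := mem_sup_span_singleton.mp hy
  rw [h.eval_add_smul hF hx, h₃ x hx, mul_zero, zero_add] at hyF
  exact right_ne_zero_of_mul hyF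

lemma IsTangentAlong.planeSection_self (h : IsTangentAlong F L n)
    (h₃ : ∀ x ∈ L, polar F x n n = 0) : PlaneSection F (L ⊔ ℂ ∙ n) L L := by
  obtain ⟨l, hl, hln⟩ := exists_dual_eq_zero_of_notMem h.notMem
  have hn := h.eval_ne_zero hF hX hL h₃
  refine ⟨by rw [finrank_sup_span_singleton h.notMem, hL], hL, hL, l, eval n F • l,
    sup_span_singleton_inf_ker hl (hln ▸ one_ne_zero), sup_span_singleton_inf_ker
      (fun x hx => by rw [LinearMap.smul_apply, hl x hx, smul_zero]) (by simpa [hln]), ?_⟩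
  intro y hy
  obtain ⟨x, hx, z, rfl⟩ := mem_sup_span_singleton.mp hy
  rw [h.eval_add_smul hF hx, h₃ x hx]
  simp only [LinearMap.smul_apply, map_add, map_smul, hl x hx, hln, smul_eq_mul]
  ring

end PlaneSection

/-! ### The equations of the curve in a chart -/

section Chart

variable (e : Fin 2 ⊕ Fin 3 ≃ Fin 5)

/-- The two points spanning the line with coordinates `a` in a chart. -/
def vec (a : Fin 2 × Fin 3 → ℂ) (u : Fin 2) : Fin 5 → ℂ := fun i => eval a (chartVec e u i)

/-- The inclusion of the coordinate subspace of `ℂ⁵` complementary to all lines of a chart. -/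
def complVec : (Fin 3 → ℂ) →ₗ[ℂ] Fin 5 → ℂ :=
  Function.ExtendByZero.linearMap ℂ fun k => e (Sum.inr k)

lemma vec_inl (a : Fin 2 × Fin 3 → ℂ) (u u' : Fin 2) :
    vec e a u (e (Sum.inl u')) = if u' = u then 1 else 0 := by
  simp only [vec, chartVec, Equiv.symm_apply_apply, Sum.elim_inl]
  split_ifs <;> simp

lemma vec_inr (a : Fin 2 × Fin 3 → ℂ) (u : Fin 2) (k : Fin 3) :
    vec e a u (e (Sum.inr k)) = a (u, k) := by
  simp [vec, chartVec]

lemma complVec_inl (c : Fin 3 → ℂ) (u : Fin 2) : complVec e c (e (Sum.inl u)) = 0 :=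
  Function.extend_apply' _ _ _ fun ⟨_, hk⟩ => Sum.inr_ne_inl (e.injective hk)

lemma complVec_inr (c : Fin 3 → ℂ) (k : Fin 3) : complVec e c (e (Sum.inr k)) = c k :=
  (e.injective.comp Sum.inr_injective).extend_apply c 0 k

variable {e}

lemma chart_ext {x y : Fin 5 → ℂ} (hl : ∀ u, x (e (Sum.inl u)) = y (e (Sum.inl u)))
    (hr : ∀ k, x (e (Sum.inr k)) = y (e (Sum.inr k))) : x = y :=
  e.surjective.forall.mpr (Sum.forall.mpr ⟨hl, hr⟩) |> funext

lemma complVec_single (k : Fin 3) :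
    complVec e (Pi.single k 1) = Pi.single (e (Sum.inr k)) 1 :=
  chart_ext (e := e) (fun u => by simp [complVec_inl]) fun l => by
    simp [complVec_inr, Pi.single_apply]

lemma vec_add_smul (a y : Fin 2 × Fin 3 → ℂ) (t : ℂ) (u : Fin 2) :
    vec e (a + t • y) u = vec e a u + t • complVec e fun k => y (u, k) :=
  chart_ext (e := e) (fun u' => by simp [vec_inl, complVec_inl])
    fun k => by simp [vec_inr, complVec_inr]

lemma eq_vec_add_complVec (a : Fin 2 × Fin 3 → ℂ) (x : Fin 5 → ℂ) :
    x = x (e (Sum.inl 0)) • vec e a 0 + x (e (Sum.inl 1)) • vec e a 1 +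
      complVec e fun k => x (e (Sum.inr k)) - x (e (Sum.inl 0)) * a (0, k)
        - x (e (Sum.inl 1)) * a (1, k) := by
  refine chart_ext (e := e) (fun u => ?_) fun k => ?_
  · fin_cases u <;> simp [vec_inl, complVec_inl]
  · simp only [Pi.add_apply, Pi.smul_apply, smul_eq_mul, vec_inr, complVec_inr]
    ring

lemma chartLine_eq_span (a : Fin 2 × Fin 3 → ℂ) :
    chartLine e a = Submodule.span ℂ {vec e a 0, vec e a 1} := by
  rw [← Matrix.range_cons_cons_empty (vec e a 0) (vec e a 1) ![], chartLine]
  congr 2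
  funext u
  fin_cases u <;> rfl

end Chart

section LineCoeff

variable {e : Fin 2 ⊕ Fin 3 ≃ Fin 5} {F : MvPolynomial (Fin 5) ℂ} {a : Fin 2 × Fin 3 → ℂ}

lemma eval_lineCoeff {G : MvPolynomial (Fin 5) ℂ} {p : MvPolynomial (Fin 2) ℂ}
    (hp : ∀ t : Fin 2 → ℂ, eval t p = eval (t 0 • vec e a 0 + t 1 • vec e a 1) G) (i j : ℕ) :
    eval a (lineCoeff e G i j) = coeff (Finsupp.single 0 i + Finsupp.single 1 j) p := by
  rw [lineCoeff, ← coeff_map]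
  congr 1
  refine MvPolynomial.funext fun t => ?_
  have h : ((eval t).comp (map (eval a))).comp (aeval fun n : Fin 5 => ∑ u : Fin 2,
      (X u * C (chartVec e u n) : MvPolynomial (Fin 2) ChartRing)).toRingHom =
      eval (t 0 • vec e a 0 + t 1 • vec e a 1) :=
    ringHom_ext (fun c => by simp [MvPolynomial.algebraMap_eq, MvPolynomial.algebraMap_apply])
      fun n => by simp [vec]
  rw [hp, ← h]
  rfl

/-- `∑ᵢ c i * t₀ⁿ⁻ⁱ t₁ⁱ`, the binary form of degree `n` with coefficients `c 0, …, c n`. -/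
def binaryForm {n : ℕ} (c : Fin (n + 1) → ℂ) : MvPolynomial (Fin 2) ℂ :=
  ∑ i : Fin (n + 1), monomial (Finsupp.single 0 (n - (i : ℕ)) + Finsupp.single 1 (i : ℕ)) (c i)

lemma eval_binaryForm {n : ℕ} (c : Fin (n + 1) → ℂ) (t : Fin 2 → ℂ) :
    eval t (binaryForm c) = ∑ i : Fin (n + 1), c i * (t 0 ^ (n - (i : ℕ)) * t 1 ^ (i : ℕ)) := by
  rw [binaryForm, map_sum]
  refine Finset.sum_congr rfl fun i _ => ?_
  rw [eval_monomial, Finsupp.prod_add_index' (by simp) (fun _ _ _ => pow_add _ _ _)]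
  simp

lemma coeff_binaryForm {n : ℕ} (c : Fin (n + 1) → ℂ) (i : Fin (n + 1)) :
    coeff (Finsupp.single 0 (n - (i : ℕ)) + Finsupp.single 1 (i : ℕ)) (binaryForm c) = c i := by
  rw [binaryForm, coeff_sum, Finset.sum_eq_single i, coeff_monomial, if_pos rfl]
  · intro j _ hj
    rw [coeff_monomial, if_neg]
    intro h
    exact hj (Fin.ext (by simpa using DFunLike.congr_fun h 1))
  · simp

/-- The four equations of the Fano surface of lines of `F = 0` in a chart. -/
def fanoEq (e : Fin 2 ⊕ Fin 3 ≃ Fin 5) (F : MvPolynomial (Fin 5) ℂ) (i : Fin 4) : ChartRing :=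
  lineCoeff e F (3 - i) i

lemma curveIdeal_eq_span :
    curveIdeal e F = Ideal.span (insert (secondTypeDet e F) (Set.range (fanoEq e F))) := by
  rw [curveIdeal]
  congr 1
  ext f
  simp [fanoEq, Fin.exists_fin_succ, eq_comm]
  tauto

variable (hF : F.IsHomogeneous 3)
include hF

lemma eval_fanoEq (a : Fin 2 × Fin 3 → ℂ) (i : Fin 4) : eval a (fanoEq e F i) =
    ![1, 3, 3, 1] i * polar F (vec e a (![0, 0, 0, 1] i)) (vec e a (![0, 0, 1, 1] i))
      (vec e a (![0, 1, 1, 1] i)) := by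
  rw [fanoEq, eval_lineCoeff (p := binaryForm _) (fun t => ?_), coeff_binaryForm (n := 3)
    fun i => ![1, 3, 3, 1] i * polar F (vec e a (![0, 0, 0, 1] i)) (vec e a (![0, 0, 1, 1] i))
      (vec e a (![0, 1, 1, 1] i))]
  rw [eval_combination hF, eval_binaryForm]

/-- The matrix of the linear map `c ↦ (polar F v₀ v₀ c, polar F v₀ v₁ c, polar F v₁ v₁ c)` on the
coordinate complement of the line: up to the factors `3, 6, 3` on its rows, the matrix of which
`secondTypeDet` is the determinant. -/
def derivMatrix (e : Fin 2 ⊕ Fin 3 ≃ Fin 5) (F : MvPolynomial (Fin 5) ℂ)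
    (a : Fin 2 × Fin 3 → ℂ) : Matrix (Fin 3) (Fin 3) ℂ :=
  Matrix.of fun r k => polar F (vec e a (![0, 0, 1] r)) (vec e a (![0, 1, 1] r))
    (complVec e (Pi.single k 1))

omit hF in
lemma derivMatrix_mulVec (a : Fin 2 × Fin 3 → ℂ) (c : Fin 3 → ℂ) (r : Fin 3) :
    (derivMatrix e F a).mulVec c r =
      polar F (vec e a (![0, 0, 1] r)) (vec e a (![0, 1, 1] r)) (complVec e c) := by
  refine Eq.trans ?_ (sum_mul_apply_single (polar F _ _ ∘ₗ complVec e) c)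
  simp only [mul_comm (c _)]
  rfl

/-- The matrix of which `secondTypeDet` is the determinant. -/
def coeffMatrix (e : Fin 2 ⊕ Fin 3 ≃ Fin 5) (F : MvPolynomial (Fin 5) ℂ) :
    Matrix (Fin 3) (Fin 3) ChartRing :=
  Matrix.of fun r k => lineCoeff e (pderiv (e (Sum.inr k)) F) (2 - (r : ℕ)) (r : ℕ)

lemma eval_coeffMatrix (a : Fin 2 × Fin 3 → ℂ) :
    (eval a).mapMatrix (coeffMatrix e F) =
      Matrix.diagonal ![3, 6, 3] * derivMatrix e F a := by
  ext r k
  rw [Matrix.diagonal_mul, RingHom.mapMatrix_apply, Matrix.map_apply, coeffMatrix, Matrix.of_apply,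
    eval_lineCoeff (p := binaryForm fun r => ![3, 6, 3] r * derivMatrix e F a r k)
    (fun t => ?_), coeff_binaryForm (n := 2)]
  rw [eval_pderiv hF, eval_binaryForm, Fin.sum_univ_three]
  simp only [map_add, LinearMap.add_apply, map_smul, LinearMap.smul_apply, smul_eq_mul]
  rw [polar_swap (vec e a 1) (vec e a 0)]
  simp [derivMatrix, complVec_single]
  ring

lemma eval_secondTypeDet_eq_zero_iff (a : Fin 2 × Fin 3 → ℂ) :
    eval a (secondTypeDet e F) = 0 ↔ (derivMatrix e F a).det = 0 := by
  have h : eval a (secondTypeDet e F) = _ := RingHom.map_det (eval a) (coeffMatrix e F)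
  rw [h, eval_coeffMatrix hF, Matrix.det_mul, Matrix.det_diagonal, Fin.prod_univ_three]
  simp

lemma memCurve_iff (a : Fin 2 × Fin 3 → ℂ) : MemCurve e F a ↔
    (∀ x ∈ chartLine e a, eval x F = 0) ∧ (derivMatrix e F a).det = 0 := by
  have hmem : MemCurve e F a ↔ curveIdeal e F ≤ RingHom.ker (eval a) := Iff.rfl
  rw [hmem, curveIdeal_eq_span, Ideal.span_le, Set.insert_subset_iff, Set.range_subset_iff,
    and_comm]
  simp only [SetLike.mem_coe, RingHom.mem_ker, eval_secondTypeDet_eq_zero_iff hF]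
  refine and_congr_left' ⟨fun h x hx => ?_, fun h i => ?_⟩
  · rw [chartLine_eq_span, Submodule.mem_span_pair] at hx
    obtain ⟨p, q, rfl⟩ := hx
    rw [eval_combination hF]
    exact Finset.sum_eq_zero fun i _ => by rw [← eval_fanoEq hF, h, zero_mul]
  · have hvec : ∀ u, vec e a u ∈ chartLine e a := fun u => Submodule.subset_span ⟨u, rfl⟩
    rw [eval_fanoEq hF, polar_eq_zero_of_forall_eval hF h (hvec _) (hvec _) (hvec _), mul_zero]

end LineCoeff

open Matrix

section Adjugate

variable {ι K : Type*} [Fintype ι] [DecidableEq ι] [Field K] {N : Matrix ι ι K} {c ρ : ι → K}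
  {k r : ι}

lemma adjugate_apply_ne_zero (hker : ∀ v, N *ᵥ v = 0 → v ∈ K ∙ c) (hρ : ρ ᵥ* N = 0)
    (hk : c k ≠ 0) (hr : ρ r ≠ 0) : N.adjugate k r ≠ 0 := by
  rw [Matrix.adjugate_apply, ne_eq, ← Matrix.exists_mulVec_eq_zero_iff]
  rintro ⟨v, hv0, hv⟩
  rw [Matrix.updateRow_mulVec, single_one_dotProduct] at hv
  have hvk : v k = 0 := by simpa using congrFun hv r
  have hNv : N *ᵥ v = Pi.single r ((N *ᵥ v) r) := funext fun s => by
    by_cases hs : s = r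
    · rw [hs, Pi.single_eq_same]
    · simpa [hs] using congrFun hv s
  have hNvr : ρ r * (N *ᵥ v) r = 0 := by
    rw [← dotProduct_single, ← hNv, dotProduct_mulVec, hρ, zero_dotProduct]
  rw [(mul_eq_zero.mp hNvr).resolve_left hr, Pi.single_zero] at hNv
  obtain ⟨μ, rfl⟩ := Submodule.mem_span_singleton.mp (hker v hNv)
  have hμ : μ = 0 := (mul_eq_zero.mp hvk).resolve_right hk
  exact hv0 (by rw [hμ, zero_smul])

lemma adjugate_row_vecMul (hN : N.det = 0) (k : ι) : N.adjugate.row k ᵥ* N = 0 := by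
  change (N.adjugate * N) k = 0
  rw [Matrix.adjugate_mul, hN, zero_smul]
  rfl

lemma adjugate_row_ne_zero (hN : N.det = 0) (hker : ∀ v, N *ᵥ v = 0 → v ∈ K ∙ c)
    (hk : c k ≠ 0) : N.adjugate.row k ≠ 0 := by
  obtain ⟨ρ, hρ0, hρ⟩ := Matrix.exists_vecMul_eq_zero_iff.mpr hN
  obtain ⟨r, hr⟩ := Function.ne_iff.mp hρ0
  exact fun h => adjugate_apply_ne_zero hker hρ hk hr (congrFun h r)

end Adjugate

section ChartLine

variable {e : Fin 2 ⊕ Fin 3 ≃ Fin 5} {F : MvPolynomial (Fin 5) ℂ} {a : Fin 2 × Fin 3 → ℂ}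
  {c : Fin 3 → ℂ}

lemma mem_chartLine_iff {x : Fin 5 → ℂ} :
    x ∈ chartLine e a ↔ ∃ p q : ℂ, p • vec e a 0 + q • vec e a 1 = x := by
  rw [chartLine_eq_span, Submodule.mem_span_pair]

lemma smul_vec_add_smul_vec_mem (p q : ℂ) : p • vec e a 0 + q • vec e a 1 ∈ chartLine e a :=
  mem_chartLine_iff.mpr ⟨p, q, rfl⟩

lemma smul_vec_add_smul_vec_inl (p q : ℂ) (u : Fin 2) :
    (p • vec e a 0 + q • vec e a 1) (e (Sum.inl u)) = ![p, q] u := by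
  fin_cases u <;> simp [vec_inl]

lemma finrank_chartLine (e : Fin 2 ⊕ Fin 3 ≃ Fin 5) (a : Fin 2 × Fin 3 → ℂ) :
    Module.finrank ℂ (chartLine e a) = 2 := by
  have hli : LinearIndependent ℂ ![vec e a 0, vec e a 1] :=
    LinearIndependent.pair_iff.mpr fun p q h => by
      have hu : ∀ u, ![p, q] u = 0 := fun u => by
        rw [← smul_vec_add_smul_vec_inl (e := e) (a := a), h, Pi.zero_apply]
      exact ⟨hu 0, hu 1⟩
  rw [chartLine_eq_span, ← Matrix.range_cons_cons_empty _ _ ![], finrank_span_eq_card hli,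
    Fintype.card_fin]

lemma complVec_mem_chartLine_iff : complVec e c ∈ chartLine e a ↔ c = 0 := by
  refine ⟨fun h => ?_, fun h => by rw [h, map_zero]; exact zero_mem _⟩
  obtain ⟨p, q, hpq⟩ := mem_chartLine_iff.mp h
  have hu : ∀ u, ![p, q] u = 0 := fun u => by
    rw [← smul_vec_add_smul_vec_inl (e := e) (a := a), hpq, complVec_inl]
  obtain rfl : p = 0 := hu 0
  obtain rfl : q = 0 := hu 1
  funext k
  simpa [complVec_inr] using (congrFun hpq (e (Sum.inr k))).symm

lemma exists_complVec_mem {P : Submodule ℂ (Fin 5 → ℂ)} (hP : chartLine e a < P) :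
    ∃ c ≠ 0, complVec e c ∈ P := by
  obtain ⟨hle, x, hxP, hx⟩ := SetLike.lt_iff_le_and_exists.mp hP
  have hline := smul_vec_add_smul_vec_mem (e := e) (a := a) (x (e (Sum.inl 0))) (x (e (Sum.inl 1)))
  have hx' := eq_vec_add_complVec (e := e) a x
  refine ⟨_, fun hc => hx ?_, (Submodule.add_mem_iff_right P (hle hline)).mp (hx' ▸ hxP)⟩
  rw [hx', hc, map_zero, add_zero]
  exact hline

lemma polar_complVec (p q : ℂ) :
    polar F (p • vec e a 0 + q • vec e a 1) (p • vec e a 0 + q • vec e a 1) (complVec e c) =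
      ![p ^ 2, 2 * p * q, q ^ 2] ⬝ᵥ (derivMatrix e F a *ᵥ c) := by
  rw [Matrix.vec3_dotProduct, derivMatrix_mulVec, derivMatrix_mulVec, derivMatrix_mulVec]
  simp only [map_add, LinearMap.add_apply, map_smul, LinearMap.smul_apply, smul_eq_mul]
  rw [polar_swap (vec e a 1) (vec e a 0)]
  simp
  ring

lemma isTangentAlong_complVec_iff : IsTangentAlong F (chartLine e a) (complVec e c) ↔
    c ≠ 0 ∧ (∀ x ∈ chartLine e a, eval x F = 0) ∧ derivMatrix e F a *ᵥ c = 0 := by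
  refine ⟨fun ⟨hc, h, ht⟩ => ⟨fun h0 => hc (complVec_mem_chartLine_iff.mpr h0), h, ?_⟩,
    fun ⟨hc, h, ht⟩ => ⟨fun hmem => hc (complVec_mem_chartLine_iff.mp hmem), h, fun x hx => ?_⟩⟩
  · have hvec : ∀ u, vec e a u ∈ chartLine e a := fun u => Submodule.subset_span ⟨u, rfl⟩
    funext r
    rw [derivMatrix_mulVec, polar_eq_zero_of_forall_polar_self ht (hvec _) (hvec _), Pi.zero_apply]
  · obtain ⟨p, q, rfl⟩ := mem_chartLine_iff.mp hx
    rw [polar_complVec, ht, dotProduct_zero]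

lemma memCurve_iff_exists (hF : F.IsHomogeneous 3) :
    MemCurve e F a ↔ ∃ c, IsTangentAlong F (chartLine e a) (complVec e c) := by
  simp only [memCurve_iff hF, isTangentAlong_complVec_iff, ← Matrix.exists_mulVec_eq_zero_iff]
  tauto

end ChartLine

section DerivMatrix

variable {e : Fin 2 ⊕ Fin 3 ≃ Fin 5} {F : MvPolynomial (Fin 5) ℂ} {a : Fin 2 × Fin 3 → ℂ}
  (hF : F.IsHomogeneous 3) (hX : IsSmooth F) (hLX : ∀ x ∈ chartLine e a, eval x F = 0)
include hF hX hLX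

lemma vecMul_derivMatrix_ne_zero {p q : ℂ} (hpq : p ≠ 0 ∨ q ≠ 0) :
    ![p ^ 2, 2 * p * q, q ^ 2] ᵥ* derivMatrix e F a ≠ 0 := by
  intro h
  have hx : p • vec e a 0 + q • vec e a 1 ∈ chartLine e a := smul_vec_add_smul_vec_mem p q
  have h0 := eq_zero_of_forall_polar_eq_zero hF hX fun y => by
    rw [eq_vec_add_complVec (e := e) a y, map_add, polar_complVec, Matrix.dotProduct_mulVec, h,
      zero_dotProduct, polar_eq_zero_of_forall_eval hF hLX hx hx
        (smul_vec_add_smul_vec_mem _ _), add_zero]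
  have hu : ∀ u, ![p, q] u = 0 := fun u => by
    rw [← smul_vec_add_smul_vec_inl (e := e) (a := a), h0, Pi.zero_apply]
  exact hpq.elim (fun h => h (hu 0)) fun h => h (hu 1)

lemma sq_ne_four_mul_of_vecMul_derivMatrix_eq_zero {ρ : Fin 3 → ℂ} (hρ0 : ρ ≠ 0)
    (hρ : ρ ᵥ* derivMatrix e F a = 0) : ρ 1 ^ 2 ≠ 4 * ρ 0 * ρ 2 := by
  intro hdisc
  obtain ⟨p, hp⟩ := IsAlgClosed.exists_pow_nat_eq (ρ 0) two_pos
  obtain ⟨q, hq⟩ := IsAlgClosed.exists_pow_nat_eq (ρ 2) two_pos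
  obtain ⟨q, hq, hpq⟩ : ∃ q, q ^ 2 = ρ 2 ∧ ρ 1 = 2 * p * q := by
    rcases sq_eq_sq_iff_eq_or_eq_neg.mp
      (show ρ 1 ^ 2 = (2 * p * q) ^ 2 by rw [hdisc, ← hp, ← hq]; ring) with h | h
    · exact ⟨q, hq, h⟩
    · exact ⟨-q, by rw [neg_sq, hq], by rw [h]; ring⟩
  have hρpq : ![p ^ 2, 2 * p * q, q ^ 2] = ρ := by
    funext r
    fin_cases r <;> simp [hp, hq, hpq]
  refine vecMul_derivMatrix_ne_zero hF hX hLX (p := p) (q := q) ?_ (hρpq ▸ hρ)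
  by_contra! h
  exact hρ0 (by rw [← hρpq, h.1, h.2]; funext r; fin_cases r <;> simp)

lemma mem_span_of_derivMatrix_mulVec_eq_zero {c c' : Fin 3 → ℂ} (hc : c ≠ 0)
    (h : derivMatrix e F a *ᵥ c = 0) (h' : derivMatrix e F a *ᵥ c' = 0) : c' ∈ ℂ ∙ c := by
  by_contra hcc'
  have hli : LinearIndependent ℂ ![c, c'] := (LinearIndependent.pair_iff' hc).mpr fun s hs =>
    hcc' (Submodule.mem_span_singleton.mpr ⟨s, hs⟩)
  have hker : 2 ≤ Module.finrank ℂ (LinearMap.ker (derivMatrix e F a).mulVecLin) := by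
    rw [← Fintype.card_fin 2, ← finrank_span_eq_card hli]
    refine Submodule.finrank_mono (Submodule.span_le.mpr ?_)
    rintro _ ⟨u, rfl⟩
    fin_cases u
    exacts [h, h']
  have hrange := (derivMatrix e F a).mulVecLin.finrank_range_add_finrank_ker
  rw [Module.finrank_fin_fun] at hrange
  obtain ⟨w, hw⟩ := finrank_le_one_iff.mp
    (show Module.finrank ℂ (LinearMap.range (derivMatrix e F a).mulVecLin) ≤ 1 by omega)
  obtain ⟨p, q, hpq, hw0⟩ := exists_binary_quadratic_eq_zero (w.1 0) (2 * w.1 1) (w.1 2)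
  refine vecMul_derivMatrix_ne_zero hF hX hLX hpq ?_
  refine dotProduct_eq_zero _ fun d => ?_
  obtain ⟨s, hs⟩ := hw ⟨_, d, rfl⟩
  have hs' : s • w.1 = derivMatrix e F a *ᵥ d := congrArg Subtype.val hs
  have hw0' : ![p ^ 2, 2 * p * q, q ^ 2] ⬝ᵥ w.1 = 0 := by
    rw [Matrix.vec3_dotProduct, ← hw0]
    simp
    ring
  rw [← Matrix.dotProduct_mulVec, ← hs', dotProduct_smul, hw0', smul_zero]

end DerivMatrix

section SecondType

variable {e : Fin 2 ⊕ Fin 3 ≃ Fin 5} {F : MvPolynomial (Fin 5) ℂ} {a : Fin 2 × Fin 3 → ℂ}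
  {c c' : Fin 3 → ℂ}

lemma exists_isTangentAlong_of_planeSection (hF : F.IsHomogeneous 3)
    {P L' : Submodule ℂ (Fin 5 → ℂ)} (h : PlaneSection F P (chartLine e a) L') :
    ∃ c, IsTangentAlong F (chartLine e a) (complVec e c) ∧
      P = chartLine e a ⊔ ℂ ∙ complVec e c ∧
      (L' = chartLine e a → ∀ x ∈ chartLine e a, polar F x (complVec e c) (complVec e c) = 0) := by
  have hlt : chartLine e a < P := lt_of_le_of_ne h.le fun hP => by
    have := h.1
    rw [← hP, h.2.1] at this
    omega
  obtain ⟨c, hc, hcP⟩ := exists_complVec_mem hlt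
  have hcL : complVec e c ∉ chartLine e a := fun hmem => hc (complVec_mem_chartLine_iff.mp hmem)
  obtain ⟨ht, h₃⟩ := h.isTangentAlong hF hcP hcL
  exact ⟨c, ht, h.eq_sup hcP hcL, h₃⟩

lemma IsTangentAlong.mem_span (hF : F.IsHomogeneous 3) (hX : IsSmooth F)
    (h : IsTangentAlong F (chartLine e a) (complVec e c))
    (h' : IsTangentAlong F (chartLine e a) (complVec e c')) : c' ∈ ℂ ∙ c := by
  rw [isTangentAlong_complVec_iff] at h h'
  exact mem_span_of_derivMatrix_mulVec_eq_zero hF hX h.2.1 h.1 h.2.2 h'.2.2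

lemma IsTangentAlong.span_complVec_eq (hF : F.IsHomogeneous 3) (hX : IsSmooth F)
    (h : IsTangentAlong F (chartLine e a) (complVec e c))
    (h' : IsTangentAlong F (chartLine e a) (complVec e c')) :
    ℂ ∙ complVec e c' = ℂ ∙ complVec e c := by
  simp only [← Set.image_singleton, ← Submodule.map_span]
  exact congrArg _ (le_antisymm
    ((Submodule.span_singleton_le_iff_mem _ _).mpr (h.mem_span hF hX h'))
    ((Submodule.span_singleton_le_iff_mem _ _).mpr (h'.mem_span hF hX h)))

lemma memCurve_iff_isSecondType (hF : F.IsHomogeneous 3) (hX : IsSmooth F) :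
    MemCurve e F a ↔ IsSecondType F (chartLine e a) := by
  rw [memCurve_iff_exists hF]
  refine ⟨fun ⟨c, h⟩ => ⟨chartLine e a ⊔ ℂ ∙ complVec e c,
    h.exists_planeSection hF hX (finrank_chartLine e a), fun P' ⟨L', hP'⟩ => ?_⟩,
    fun ⟨P, ⟨L', hP⟩, _⟩ => ?_⟩
  · obtain ⟨c', h', rfl, -⟩ := exists_isTangentAlong_of_planeSection hF hP'
    rw [h.span_complVec_eq hF hX h']
  · obtain ⟨c, h, -⟩ := exists_isTangentAlong_of_planeSection hF hP
    exact ⟨c, h⟩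

lemma IsTangentAlong.isTripleLine_iff (hF : F.IsHomogeneous 3) (hX : IsSmooth F)
    (h : IsTangentAlong F (chartLine e a) (complVec e c)) : IsTripleLine F (chartLine e a) ↔
      ∀ x ∈ chartLine e a, polar F x (complVec e c) (complVec e c) = 0 := by
  refine ⟨fun ⟨P, hP⟩ x hx => ?_,
    fun h₃ => ⟨_, h.planeSection_self hF hX (finrank_chartLine e a) h₃⟩⟩
  obtain ⟨c', h', -, h₃⟩ := exists_isTangentAlong_of_planeSection hF hP
  obtain ⟨μ, rfl⟩ := Submodule.mem_span_singleton.mp (h'.mem_span hF hX h)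
  simp [h₃ rfl x hx]

end SecondType

/-! ### The curve to second order at one of its points -/

section Trilinear

variable {σ k V : Type*} [Field k] [Infinite k] [AddCommGroup V] [Module k V]
  {a w : σ → k} {f : MvPolynomial σ k} {x x' y y' z z' : V}

lemma eval_taylorForm_of_trilinear (T : V →ₗ[k] V →ₗ[k] V →ₗ[k] k)
    (hf : ∀ s : k, eval (a + s • w) f = T (x + s • x') (y + s • y') (z + s • z')) :
    eval w (taylorForm a 1 f) = T x' y z + T x y' z + T x y z' ∧
      eval w (taylorForm a 2 f) = T x' y' z + T x' y z' + T x y' z' := by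
  have hp (s : k) : eval (a + s • w) f = (Polynomial.C (T x y z) +
      Polynomial.C (T x' y z + T x y' z + T x y z') * Polynomial.X +
      Polynomial.C (T x' y' z + T x' y z' + T x y' z') * Polynomial.X ^ 2 +
      Polynomial.C (T x' y' z') * Polynomial.X ^ 3).eval s := by
    simp [hf]
    ring
  constructor <;> rw [eval_taylorForm_eq_coeff w hp]
  · simp [Polynomial.coeff_C, -map_add]
  · simp [-map_add]

end Trilinear

section Tangent

lemma eq_zero_of_dotProduct_eq_zero {K : Type*} [Field K] {ρ : Fin 3 → K}
    (hdisc : ρ 1 ^ 2 ≠ 4 * ρ 0 * ρ 2) {q : Fin 2 → Fin 3 → K} (hρq : ∀ u, ρ ⬝ᵥ q u = 0)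
    (hq : ∀ i, ![q 0 0, q 1 0 + 2 * q 0 1, q 0 2 + 2 * q 1 1, q 1 2] i = 0) : q = 0 := by
  have h₀ : q 0 0 = 0 := hq 0
  have h₁ : q 1 0 + 2 * q 0 1 = 0 := hq 1
  have h₂ : q 0 2 + 2 * q 1 1 = 0 := hq 2
  have h₃ : q 1 2 = 0 := hq 3
  simp only [Matrix.vec3_dotProduct] at hρq
  have hdisc' : ρ 1 ^ 2 - 4 * ρ 0 * ρ 2 ≠ 0 := sub_ne_zero.mpr hdisc
  have h₀₁ : q 0 1 = 0 := (mul_eq_zero.mp (show (ρ 1 ^ 2 - 4 * ρ 0 * ρ 2) * q 0 1 = 0 by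
    linear_combination ρ 1 * hρq 0 - ρ 0 * ρ 1 * h₀ - ρ 1 * ρ 2 * h₂ +
      2 * ρ 2 * hρq 1 - 2 * ρ 2 * ρ 0 * h₁ - 2 * ρ 2 * ρ 2 * h₃)).resolve_left hdisc'
  have h₁₁ : q 1 1 = 0 := (mul_eq_zero.mp (show (ρ 1 ^ 2 - 4 * ρ 0 * ρ 2) * q 1 1 = 0 by
    linear_combination ρ 1 * hρq 1 - ρ 2 * ρ 1 * h₃ - ρ 1 * ρ 0 * h₁ +
      2 * ρ 0 * hρq 0 - 2 * ρ 0 * ρ 0 * h₀ - 2 * ρ 0 * ρ 2 * h₂)).resolve_left hdisc'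
  rw [h₀₁, mul_zero, add_zero] at h₁
  rw [h₁₁, mul_zero, add_zero] at h₂
  funext u r
  fin_cases u <;> fin_cases r
  exacts [h₀, h₀₁, h₂, h₁, h₁₁, h₃]

variable {e : Fin 2 ⊕ Fin 3 ≃ Fin 5} {F : MvPolynomial (Fin 5) ℂ} {a : Fin 2 × Fin 3 → ℂ}
  {c : Fin 3 → ℂ}

/-- The tangent vector of a chart which moves the point `v_u` of a line in the direction
`l u • complVec e c`. -/
def tangent (c : Fin 3 → ℂ) : (Fin 2 → ℂ) →ₗ[ℂ] Fin 2 × Fin 3 → ℂ :=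
  LinearMap.pi fun p => (LinearMap.proj p.1).smulRight (c p.2)

lemma tangent_apply (c : Fin 3 → ℂ) (l : Fin 2 → ℂ) (u : Fin 2) :
    (fun k => tangent c l (u, k)) = l u • c := rfl

lemma tangent_injective (hc : c ≠ 0) : Function.Injective (tangent c) := by
  refine (injective_iff_map_eq_zero _).mpr fun l hl => funext fun u => ?_
  refine (smul_eq_zero.mp ?_).resolve_right hc
  rw [← tangent_apply, hl]
  rfl

/-- The linear form `m` on the line for which `F = z ^ 2 * (3 * m + z * F n)` on the plane spanned
by the line and `n = complVec e c`, when `n` is tangent along the line: its values at `v₀`, `v₁`. -/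
def residualForm (e : Fin 2 ⊕ Fin 3 ≃ Fin 5) (F : MvPolynomial (Fin 5) ℂ) (a : Fin 2 × Fin 3 → ℂ)
    (c : Fin 3 → ℂ) (u : Fin 2) : ℂ :=
  polar F (vec e a u) (complVec e c) (complVec e c)

/-- The coefficients of the derivative of `F` in the direction `complVec e c` along the general
line of a chart. -/
def derivCoeff (e : Fin 2 ⊕ Fin 3 ≃ Fin 5) (F : MvPolynomial (Fin 5) ℂ) (c : Fin 3 → ℂ) :
    Fin 3 → ChartRing :=
  coeffMatrix e F *ᵥ fun k => C (c k)

variable (hF : F.IsHomogeneous 3)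
include hF

lemma eval_taylorForm_fanoEq (y : Fin 2 × Fin 3 → ℂ) (i : Fin 4) :
    let T := (![1, 3, 3, 1] i : ℂ) • polar F
    let v := vec e a
    let n := fun u => complVec e fun k => y (u, k)
    let r := ![0, 0, 0, 1] i
    let s := ![0, 0, 1, 1] i
    let t := ![0, 1, 1, 1] i
    eval y (taylorForm a 1 (fanoEq e F i)) =
        T (n r) (v s) (v t) + T (v r) (n s) (v t) + T (v r) (v s) (n t) ∧
      eval y (taylorForm a 2 (fanoEq e F i)) =
        T (n r) (n s) (v t) + T (n r) (v s) (n t) + T (v r) (n s) (n t) := by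
  intro T v n r s t
  refine eval_taylorForm_of_trilinear T fun z => ?_
  rw [eval_fanoEq hF, vec_add_smul, vec_add_smul, vec_add_smul]
  rfl

lemma differential_fanoEq (y : Fin 2 × Fin 3 → ℂ) (i : Fin 4) :
    differential a (fanoEq e F i) y =
      let q := fun u => derivMatrix e F a *ᵥ fun k => y (u, k)
      3 * ![q 0 0, q 1 0 + 2 * q 0 1, q 0 2 + 2 * q 1 1, q 1 2] i := by
  rw [← eval_taylorForm_one, (eval_taylorForm_fanoEq hF y i).1]
  simp only [derivMatrix_mulVec, LinearMap.smul_apply, smul_eq_mul]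
  rw [polar_swap, ← polar_rotate, polar_swap_right _ (complVec e _)]
  fin_cases i <;> simp [polar_swap (vec e a 1) (vec e a 0)] <;> ring

lemma eval_taylorForm_two_fanoEq_tangent (hm : residualForm e F a c = 0) (l : Fin 2 → ℂ)
    (i : Fin 4) : eval (tangent c l) (taylorForm a 2 (fanoEq e F i)) = 0 := by
  have hm₀ (u : Fin 2) : polar F (vec e a u) (complVec e c) (complVec e c) = 0 := congrFun hm u
  have hm₁ (u : Fin 2) : polar F (complVec e c) (complVec e c) (vec e a u) = 0 := by
    rw [← polar_rotate, hm₀]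
  have hm₂ (u : Fin 2) : polar F (complVec e c) (vec e a u) (complVec e c) = 0 := by
    rw [polar_swap, hm₀]
  rw [(eval_taylorForm_fanoEq hF _ i).2]
  simp [tangent_apply, hm₀, hm₁, hm₂]

lemma forall_differential_fanoEq_eq_zero_iff (hX : IsSmooth F)
    (h : IsTangentAlong F (chartLine e a) (complVec e c)) (w : Fin 2 × Fin 3 → ℂ) :
    (∀ i, differential a (fanoEq e F i) w = 0) ↔ w ∈ LinearMap.range (tangent c) := by
  obtain ⟨hc, hLX, hMc⟩ := isTangentAlong_complVec_iff.mp h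
  simp only [differential_fanoEq hF, mul_eq_zero, OfNat.ofNat_ne_zero, false_or]
  refine ⟨fun hw => ?_, fun ⟨l, hl⟩ i => ?_⟩
  · obtain ⟨ρ, hρ0, hρ⟩ := Matrix.exists_vecMul_eq_zero_iff.mpr
      (Matrix.exists_mulVec_eq_zero_iff.mp ⟨c, hc, hMc⟩)
    have hq : (fun u => derivMatrix e F a *ᵥ fun k => w (u, k)) = 0 := eq_zero_of_dotProduct_eq_zero
      (sq_ne_four_mul_of_vecMul_derivMatrix_eq_zero hF hX hLX hρ0 hρ)
      (fun u => by rw [dotProduct_mulVec, hρ, zero_dotProduct]) hw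
    choose l hl using fun u => Submodule.mem_span_singleton.mp
      (mem_span_of_derivMatrix_mulVec_eq_zero hF hX hLX hc hMc (congrFun hq u))
    exact ⟨l, funext fun p => congrFun (hl p.1) p.2⟩
  · have hq (u : Fin 2) : derivMatrix e F a *ᵥ (fun k => w (u, k)) = 0 := by
      rw [← hl, tangent_apply, Matrix.mulVec_smul, hMc, smul_zero]
    fin_cases i <;> simp [hq]

lemma eval_derivCoeff (b : Fin 2 × Fin 3 → ℂ) (r : Fin 3) :
    eval b (derivCoeff e F c r) = ![3, 6, 3] r *
      polar F (vec e b (![0, 0, 1] r)) (vec e b (![0, 1, 1] r)) (complVec e c) := by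
  rw [derivCoeff, RingHom.map_mulVec]
  have hc : (eval b ∘ fun k => C (c k)) = c := funext fun k => eval_C _
  rw [hc, ← RingHom.mapMatrix_apply, eval_coeffMatrix hF, ← Matrix.mulVec_mulVec,
    Matrix.mulVec_diagonal, derivMatrix_mulVec]

lemma eval_taylorForm_derivCoeff (l : Fin 2 → ℂ) (r : Fin 3) :
    let m := residualForm e F a c
    let s := ![0, 0, 1] r
    let t := ![0, 1, 1] r
    eval (tangent c l) (taylorForm a 1 (derivCoeff e F c r)) =
        ![3, 6, 3] r * (l s * m t + l t * m s) ∧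
      eval (tangent c l) (taylorForm a 2 (derivCoeff e F c r)) =
        ![3, 6, 3] r * (eval (complVec e c) F * (l s * l t)) := by
  intro m s t
  obtain ⟨h₁, h₂⟩ := eval_taylorForm_of_trilinear (x := vec e a s) (x' := l s • complVec e c)
    (y := vec e a t) (y' := l t • complVec e c) (z := complVec e c) (z' := 0) (w := tangent c l)
    (f := derivCoeff e F c r) (a := a) ((![3, 6, 3] r : ℂ) • polar F) fun z => by
      rw [eval_derivCoeff hF, vec_add_smul, vec_add_smul, tangent_apply, tangent_apply,
        map_smul, map_smul, smul_zero, add_zero]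
      rfl
  rw [h₁, h₂, eval_eq_polar hF]
  simp only [map_smul, map_zero, LinearMap.smul_apply, smul_eq_mul, m, residualForm]
  rw [polar_swap (complVec e c) (vec e a t)]
  constructor <;> ring

omit hF in
lemma mul_eval_taylorForm_secondTypeDet {n : ℕ} {w : Fin 2 × Fin 3 → ℂ} (hw : ∀ r, ∀ i < n,
    eval w (taylorForm a i (derivCoeff e F c r)) = 0) (k : Fin 3) :
    c k * eval w (taylorForm a n (secondTypeDet e F)) =
      ((eval a).mapMatrix (coeffMatrix e F)).adjugate.row k ⬝ᵥ
        fun r => eval w (taylorForm a n (derivCoeff e F c r)) := by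
  have hdet : c k • secondTypeDet e F =
      ∑ r, (coeffMatrix e F).adjugate k r * derivCoeff e F c r := by
    change _ = ((coeffMatrix e F).adjugate *ᵥ (coeffMatrix e F *ᵥ fun k => C (c k))) k
    rw [Matrix.mulVec_mulVec, Matrix.adjugate_mul, Matrix.smul_mulVec, Matrix.one_mulVec,
      smul_eq_C_mul, mul_comm]
    rfl
  have hT := congrArg (fun f => eval w (taylorForm a n f)) hdet
  simp only [map_smul, smul_eval, map_sum, eval_taylorForm_mul (hw _)] at hT
  rw [hT, ← RingHom.map_adjugate]
  rfl

lemma exists_taylorForm_secondTypeDet (hX : IsSmooth F)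
    (h : IsTangentAlong F (chartLine e a) (complVec e c)) :
    ∃ ρ : Fin 3 → ℂ, ρ 1 ^ 2 ≠ 4 * ρ 0 * ρ 2 ∧ ∀ (n : ℕ) (w : Fin 2 × Fin 3 → ℂ) (q : Fin 3 → ℂ),
      (∀ r, ∀ i < n, eval w (taylorForm a i (derivCoeff e F c r)) = 0) →
      (∀ r, eval w (taylorForm a n (derivCoeff e F c r)) = ![3, 6, 3] r * q r) →
      eval w (taylorForm a n (secondTypeDet e F)) = ρ ⬝ᵥ q := by
  obtain ⟨hc, hLX, hMc⟩ := isTangentAlong_complVec_iff.mp h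
  obtain ⟨k, hk⟩ := Function.ne_iff.mp hc
  set N := (eval a).mapMatrix (coeffMatrix e F)
  have hNM : N = Matrix.diagonal ![3, 6, 3] * derivMatrix e F a := eval_coeffMatrix hF a
  have hdetN : N.det = 0 := by
    rw [hNM, Matrix.det_mul, Matrix.exists_mulVec_eq_zero_iff.mp ⟨c, hc, hMc⟩, mul_zero]
  have hκ : ∀ r, (![3, 6, 3] : Fin 3 → ℂ) r ≠ 0 := by simp [Fin.forall_fin_succ]
  have hρ0 : N.adjugate.row k ≠ 0 := adjugate_row_ne_zero hdetN (fun v hv =>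
    mem_span_of_derivMatrix_mulVec_eq_zero hF hX hLX hc hMc (funext fun r => by
      have := congrFun hv r
      rw [hNM, ← Matrix.mulVec_mulVec, Matrix.mulVec_diagonal] at this
      exact (mul_eq_zero.mp this).resolve_left (hκ r))) hk
  refine ⟨(c k)⁻¹ • (N.adjugate.row k ᵥ* Matrix.diagonal ![3, 6, 3]), ?_, fun n w q hw hq => ?_⟩
  · refine sq_ne_four_mul_of_vecMul_derivMatrix_eq_zero hF hX hLX (fun h0 => hρ0 ?_) ?_
    · funext r
      have := congrFun ((smul_eq_zero.mp h0).resolve_left (inv_ne_zero hk)) r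
      rw [Matrix.vecMul_diagonal] at this
      exact (mul_eq_zero.mp this).resolve_right (hκ r)
    · rw [Matrix.smul_vecMul, Matrix.vecMul_vecMul, ← hNM, adjugate_row_vecMul hdetN, smul_zero]
  · rw [← mul_right_inj' hk, mul_eval_taylorForm_secondTypeDet hw, funext hq, smul_dotProduct,
      smul_eq_mul, mul_inv_cancel_left₀ hk, ← Matrix.dotProduct_mulVec]
    congr 1
    funext r
    rw [Matrix.mulVec_diagonal]

lemma exists_taylorForm_secondTypeDet_tangent (hX : IsSmooth F)
    (h : IsTangentAlong F (chartLine e a) (complVec e c)) :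
    let m := residualForm e F a c
    ∃ ρ : Fin 3 → ℂ, ρ 1 ^ 2 ≠ 4 * ρ 0 * ρ 2 ∧
      (∀ l, differential a (secondTypeDet e F) (tangent c l) =
        ρ ⬝ᵥ ![2 * l 0 * m 0, l 0 * m 1 + l 1 * m 0, 2 * l 1 * m 1]) ∧
      (m = 0 → ∀ l, eval (tangent c l) (taylorForm a 2 (secondTypeDet e F)) =
        eval (complVec e c) F * ρ ⬝ᵥ ![l 0 ^ 2, l 0 * l 1, l 1 ^ 2]) := by
  intro m
  obtain ⟨-, -, hMc⟩ := isTangentAlong_complVec_iff.mp h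
  obtain ⟨ρ, hdisc, hρ⟩ := exists_taylorForm_secondTypeDet hF hX h
  have hf₀ (w : Fin 2 × Fin 3 → ℂ) (r : Fin 3) :
      eval w (taylorForm a 0 (derivCoeff e F c r)) = 0 := by
    rw [taylorForm_zero, eval_C, eval_derivCoeff hF, ← derivMatrix_mulVec, hMc,
      Pi.zero_apply, mul_zero]
  have hf₁ (l : Fin 2 → ℂ) (r : Fin 3) :=
    (eval_taylorForm_derivCoeff (e := e) (a := a) (c := c) hF l r).1
  refine ⟨ρ, hdisc, fun l => ?_, fun hm l => ?_⟩
  · rw [← eval_taylorForm_one, hρ 1 _ _ (fun r i hi => ?_) (hf₁ l)]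
    · congr 1
      funext r
      fin_cases r <;> simp [m] <;> ring
    · rw [Nat.lt_one_iff.mp hi, hf₀]
  · rw [hρ 2 _ _ (fun r i hi => ?_) fun r => (eval_taylorForm_derivCoeff hF l r).2]
    · rw [← smul_eq_mul (eval (complVec e c) F), ← dotProduct_smul]
      congr 1
      funext r
      fin_cases r <;> simp [pow_two]
    · interval_cases i
      · exact hf₀ _ r
      · simp [hf₁ l r, show residualForm e F a c = 0 from hm]

end Tangent

/-! ### Local structure of the curve -/

section BinaryForms

variable {K : Type*} [Field K]

lemma mul_add_mul_eq_zero_iff_mem_span {P Q : K} (h : P ≠ 0 ∨ Q ≠ 0) {l : Fin 2 → K} :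
    P * l 0 + Q * l 1 = 0 ↔ l ∈ K ∙ ![-Q, P] := by
  rw [Submodule.mem_span_singleton]
  refine ⟨fun hl => ?_, fun ⟨t, ht⟩ => by simp [← ht]; ring⟩
  obtain hP | hQ := h
  · refine ⟨l 1 / P, funext <| Fin.forall_fin_two.mpr ⟨?_, by simp [hP]⟩⟩
    rw [Pi.smul_apply, smul_eq_mul, Matrix.cons_val_zero, div_mul_eq_mul_div, div_eq_iff hP]
    linear_combination -hl
  · refine ⟨-l 0 / Q, funext <| Fin.forall_fin_two.mpr ⟨by simp [hQ], ?_⟩⟩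
    rw [Pi.smul_apply, smul_eq_mul, Matrix.cons_val_one, Matrix.cons_val_zero, div_mul_eq_mul_div,
      div_eq_iff hQ]
    linear_combination -hl

lemma polar_ne_zero_of_sq_ne_four_mul {ρ : Fin 3 → K} (hρ : ρ 1 ^ 2 ≠ 4 * ρ 0 * ρ 2)
    {m : Fin 2 → K} (hm : m ≠ 0) :
    2 * ρ 0 * m 0 + ρ 1 * m 1 ≠ 0 ∨ ρ 1 * m 0 + 2 * ρ 2 * m 1 ≠ 0 := by
  by_contra! h
  have h₀ : (ρ 1 ^ 2 - 4 * ρ 0 * ρ 2) * m 0 = 0 := by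
    linear_combination ρ 1 * h.2 - 2 * ρ 2 * h.1
  have h₁ : (ρ 1 ^ 2 - 4 * ρ 0 * ρ 2) * m 1 = 0 := by
    linear_combination ρ 1 * h.1 - 2 * ρ 0 * h.2
  exact hm <| funext <| Fin.forall_fin_two.mpr
    ⟨(mul_eq_zero.mp h₀).resolve_left (sub_ne_zero.mpr hρ),
      (mul_eq_zero.mp h₁).resolve_left (sub_ne_zero.mpr hρ)⟩

lemma exists_isotropic_pair [IsAlgClosed K] [NeZero (2 : K)] {ρ : Fin 3 → K}
    (hρ : ρ 1 ^ 2 ≠ 4 * ρ 0 * ρ 2) :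
    let q := fun l : Fin 2 → K => ρ ⬝ᵥ ![l 0 ^ 2, l 0 * l 1, l 1 ^ 2]
    ∃ l l', LinearIndependent K ![l, l'] ∧ q l = 0 ∧ q l' = 0 ∧ q (l + l') ≠ 0 := by
  intro q
  have hq (s t : K) : q ![s, t] = ρ 0 * s ^ 2 + ρ 1 * (s * t) + ρ 2 * t ^ 2 :=
    Matrix.vec3_dotProduct _ _
  have hli {s t s' t' : K} (h : s * t' - t * s' ≠ 0) :
      LinearIndependent K ![![s, t], ![s', t']] :=
    Matrix.linearIndependent_rows_of_det_ne_zero (A := !![s, t; s', t'])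
      (by rwa [Matrix.det_fin_two_of])
  by_cases h₀ : ρ 0 = 0
  · have h₁ : ρ 1 ≠ 0 := by simpa [h₀] using hρ
    refine ⟨![1, 0], ![-ρ 2, ρ 1], hli (by simpa using h₁), ?_, ?_, ?_⟩
    · simp [hq, h₀]
    · rw [hq, h₀]; ring
    · rw [Matrix.cons_add_cons, Matrix.cons_add_cons, Matrix.empty_add_empty, hq, h₀]
      convert pow_ne_zero 2 h₁ using 1
      ring
  · obtain ⟨δ, hδ⟩ := IsAlgClosed.exists_pow_nat_eq (ρ 1 ^ 2 - 4 * ρ 0 * ρ 2) two_pos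
    have hδ0 : δ ≠ 0 := by
      rintro rfl
      exact hρ (by linear_combination -hδ)
    have h2 : (2 : K) ≠ 0 := two_ne_zero
    refine ⟨![-ρ 1 + δ, 2 * ρ 0], ![-ρ 1 - δ, 2 * ρ 0], hli ?_, ?_, ?_, ?_⟩
    · convert mul_ne_zero (mul_ne_zero (pow_ne_zero 2 h2) h₀) hδ0 using 1
      ring
    · rw [hq]; linear_combination ρ 0 * hδ
    · rw [hq]; linear_combination ρ 0 * hδ
    · rw [Matrix.cons_add_cons, Matrix.cons_add_cons, Matrix.empty_add_empty, hq]
      convert mul_ne_zero (mul_ne_zero (pow_ne_zero 2 h2) h₀)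
        (neg_ne_zero.mpr (pow_ne_zero 2 hδ0)) using 1
      linear_combination 4 * ρ 0 * hδ

end BinaryForms

section LocalStructure

variable {e : Fin 2 ⊕ Fin 3 ≃ Fin 5} {F : MvPolynomial (Fin 5) ℂ} {a : Fin 2 × Fin 3 → ℂ}
  {c : Fin 3 → ℂ}

lemma comap_pointIdeal (h : MemCurve e F a) :
    (pointIdeal h).comap (Ideal.Quotient.mk (curveIdeal e F)) = maxIdeal a :=
  Ideal.ext fun _ => Iff.rfl

lemma secondTypeDet_mem_maxIdeal (h : MemCurve e F a) : secondTypeDet e F ∈ maxIdeal a :=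
  h _ (curveIdeal_eq_span (e := e) ▸ Ideal.subset_span (Set.mem_insert _ _))

lemma fanoEq_mem_maxIdeal (h : MemCurve e F a) (i : Fin 4) : fanoEq e F i ∈ maxIdeal a :=
  h _ (curveIdeal_eq_span (e := e) ▸ Ideal.subset_span (Set.mem_insert_of_mem _ ⟨i, rfl⟩))

variable (hF : F.IsHomogeneous 3) (hX : IsSmooth F)
include hF hX

lemma isTripleLine_iff_residualForm (hc : IsTangentAlong F (chartLine e a) (complVec e c)) :
    IsTripleLine F (chartLine e a) ↔ residualForm e F a c = 0 := by
  rw [hc.isTripleLine_iff hF hX]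
  refine ⟨fun h => funext fun u => h _ (Submodule.subset_span ⟨u, rfl⟩), fun h x hx => ?_⟩
  obtain ⟨p, q, rfl⟩ := mem_chartLine_iff.mp hx
  have h' (u : Fin 2) : polar F (vec e a u) (complVec e c) (complVec e c) = 0 := congrFun h u
  simp only [map_add, map_smul, LinearMap.add_apply, LinearMap.smul_apply, h', smul_zero, add_zero]

lemma exists_forall_differential_eq_zero_iff
    (hc : IsTangentAlong F (chartLine e a) (complVec e c)) (hm : residualForm e F a c ≠ 0) :
    ∃ Y ≠ 0, ∀ w, differential a (secondTypeDet e F) w = 0 ∧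
      (∀ i, differential a (fanoEq e F i) w = 0) ↔ w ∈ ℂ ∙ Y := by
  obtain ⟨ρ, hρ, hdet, -⟩ := exists_taylorForm_secondTypeDet_tangent hF hX hc
  set m := residualForm e F a c
  set P := 2 * ρ 0 * m 0 + ρ 1 * m 1
  set Q := ρ 1 * m 0 + 2 * ρ 2 * m 1
  have hPQ : P ≠ 0 ∨ Q ≠ 0 := polar_ne_zero_of_sq_ne_four_mul hρ hm
  have hY : ![-Q, P] ≠ 0 := fun h =>
    hPQ.elim (fun hP => hP (congrFun h 1)) fun hQ => hQ (neg_eq_zero.mp (congrFun h 0))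
  have hker (l : Fin 2 → ℂ) : differential a (secondTypeDet e F) (tangent c l) = 0 ↔
      l ∈ ℂ ∙ ![-Q, P] := by
    rw [← mul_add_mul_eq_zero_iff_mem_span hPQ, hdet, Matrix.vec3_dotProduct]
    simp [P, Q]
    ring_nf
  refine ⟨tangent c ![-Q, P], (map_ne_zero_iff _
    (tangent_injective (isTangentAlong_complVec_iff.mp hc).1)).mpr hY, fun w => ?_⟩
  rw [forall_differential_fanoEq_eq_zero_iff hF hX hc, ← Set.image_singleton, ← Submodule.map_span,
    Submodule.mem_map]
  constructor
  · rintro ⟨hl, l, rfl⟩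
    exact ⟨l, (hker l).mp hl, rfl⟩
  · rintro ⟨l, hl, rfl⟩
    exact ⟨(hker l).mpr hl, l, rfl⟩

lemma isReduced_and_isRegularLocalRing (h : MemCurve e F a)
    (hc : IsTangentAlong F (chartLine e a) (complVec e c)) (hm : residualForm e F a c ≠ 0) :
    IsReduced (Localization.AtPrime (pointIdeal h)) ∧
      IsRegularLocalRing (Localization.AtPrime (pointIdeal h)) := by
  obtain ⟨Y, hY, hker⟩ := exists_forall_differential_eq_zero_iff hF hX hc hm
  refine isReduced_and_isRegularLocalRing_of_differential
    (G := (Fin.cons (secondTypeDet e F) (fanoEq e F) : Fin 5 → ChartRing)) (by simp)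
    (by rw [Fin.range_cons, curveIdeal_eq_span]) (comap_pointIdeal h)
    (Fin.forall_fin_succ.mpr ⟨secondTypeDet_mem_maxIdeal h, fanoEq_mem_maxIdeal h⟩) hY fun w => ?_
  rw [Fin.forall_fin_succ]
  exact hker w

lemma exists_isNode_of_isTripleLine (h : MemCurve e F a)
    (hc : IsTangentAlong F (chartLine e a) (complVec e c)) (hm : residualForm e F a c = 0) :
    ∃ (x y : Localization.AtPrime (pointIdeal h))
      (φ ψ : Localization.AtPrime (pointIdeal h) →+* PowerSeries ℂ), IsNode x y φ ψ := by
  obtain ⟨ρ, hρ, hdet₁, hdet₂⟩ := exists_taylorForm_secondTypeDet_tangent hF hX hc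
  have hn : eval (complVec e c) F ≠ 0 := hc.eval_ne_zero hF hX (finrank_chartLine e a)
    ((hc.isTripleLine_iff hF hX).mp ((isTripleLine_iff_residualForm hF hX hc).mpr hm))
  obtain ⟨l, l', hli, hl, hl', hll'⟩ := exists_isotropic_pair hρ
  have hspan : Submodule.span ℂ {tangent c l, tangent c l'} = LinearMap.range (tangent c) := by
    rw [← Set.image_pair, ← Submodule.map_span, ← Matrix.range_cons_cons_empty l l' ![],
      hli.span_eq_top_of_card_eq_finrank (by simp), Submodule.map_top]
  have hinj := tangent_injective (isTangentAlong_complVec_iff.mp hc).1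
  refine exists_isNode (Y₁ := tangent c l) (Y₂ := tangent c l') (by simp) curveIdeal_eq_span
    (comap_pointIdeal h) (fanoEq_mem_maxIdeal h) (secondTypeDet_mem_maxIdeal h) ?_
    (fun w => ?_) ?_ ?_ ?_ ?_ ?_
  · have hcomp : ![tangent c l, tangent c l'] = tangent c ∘ ![l, l'] :=
      funext <| Fin.forall_fin_two.mpr ⟨rfl, rfl⟩
    rw [hcomp]
    exact hli.map' _ (LinearMap.ker_eq_bot.mpr hinj)
  · rw [hspan, forall_differential_fanoEq_eq_zero_iff hF hX hc]
  · rw [hspan]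
    rintro _ ⟨v, rfl⟩
    rw [hdet₁, hm]
    simp
  · rw [hspan]
    rintro _ ⟨v, rfl⟩ i
    exact eval_taylorForm_two_fanoEq_tangent hF hm v i
  · rw [hdet₂ hm]
    exact mul_eq_zero_of_right _ hl
  · rw [hdet₂ hm]
    exact mul_eq_zero_of_right _ hl'
  · rw [← map_add, hdet₂ hm]
    exact mul_ne_zero hn hll'

lemma isReduced_localization_pointIdeal (h : MemCurve e F a) :
    IsReduced (Localization.AtPrime (pointIdeal h)) := by
  obtain ⟨c, hc⟩ := (memCurve_iff_exists hF).mp h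
  by_cases hm : residualForm e F a c = 0
  · obtain ⟨x, y, φ, ψ, hxy⟩ := exists_isNode_of_isTripleLine hF hX h hc hm
    exact hxy.isReduced
  · exact (isReduced_and_isRegularLocalRing hF hX h hc hm).1

lemma isRegularLocalRing_localization_pointIdeal_iff (h : MemCurve e F a) :
    IsRegularLocalRing (Localization.AtPrime (pointIdeal h)) ↔
      ¬ IsTripleLine F (chartLine e a) := by
  obtain ⟨c, hc⟩ := (memCurve_iff_exists hF).mp h
  rw [isTripleLine_iff_residualForm hF hX hc]
  refine ⟨fun hreg hm => ?_, fun hm => (isReduced_and_isRegularLocalRing hF hX h hc hm).2⟩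
  obtain ⟨x, y, φ, ψ, hxy⟩ := exists_isNode_of_isTripleLine hF hX h hc hm
  exact hxy.not_isRegularLocalRing hreg

end LocalStructure

section Charts

lemma exists_equiv_inl {i j : Fin 5} (hij : i ≠ j) :
    ∃ e : Fin 2 ⊕ Fin 3 ≃ Fin 5, e (Sum.inl 0) = i ∧ e (Sum.inl 1) = j := by
  let e₁ : Fin 2 ⊕ Fin 3 ≃ Fin 5 := finSumFinEquiv
  let e₂ := e₁.trans (Equiv.swap (e₁ (Sum.inl 0)) i)
  have h₂ : e₂ (Sum.inl 0) = i := by simp [e₂]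
  have hi : i ≠ e₂ (Sum.inl 1) := by
    rw [← h₂, e₂.injective.ne_iff]
    simp
  refine ⟨e₂.trans (Equiv.swap (e₂ (Sum.inl 1)) j), ?_, by simp⟩
  rw [Equiv.trans_apply, h₂, Equiv.swap_apply_of_ne_of_ne hi hij]

lemma exists_mem_apply_eq {ι K : Type*} [Field K] {L : Submodule K (ι → K)}
    (hL : Module.finrank K L = 2) : ∃ i j, i ≠ j ∧ ∃ x ∈ L, ∃ y ∈ L,
      x i = 1 ∧ x j = 0 ∧ y i = 0 ∧ y j = 1 := by
  have hne : L ≠ ⊥ := by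
    rintro rfl
    simp at hL
  obtain ⟨x, hx, hx0⟩ := Submodule.exists_mem_ne_zero_of_ne_bot hne
  obtain ⟨i, hi : x i ≠ 0⟩ := Function.ne_iff.mp hx0
  have hker : LinearMap.ker ((LinearMap.proj i : (ι → K) →ₗ[K] K).domRestrict L) ≠ ⊥ :=
    have := Module.finite_of_finrank_eq_succ hL
    LinearMap.ker_ne_bot_of_finrank_lt (by rw [hL, Module.finrank_self]; exact one_lt_two)
  obtain ⟨⟨y, hy⟩, hyi : y i = 0, hy0⟩ := Submodule.exists_mem_ne_zero_of_ne_bot hker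
  obtain ⟨j, hj : y j ≠ 0⟩ := Function.ne_iff.mp fun h => hy0 (Subtype.ext h)
  refine ⟨i, j, fun hij => hj (hij ▸ hyi), (x i)⁻¹ • (x - (x j / y j) • y),
    L.smul_mem _ (L.sub_mem hx (L.smul_mem _ hy)), (y j)⁻¹ • y, L.smul_mem _ hy, ?_⟩
  simp [hyi, hi, hj]

lemma exists_chartLine_eq {L : Submodule ℂ (Fin 5 → ℂ)} (hL : Module.finrank ℂ L = 2) :
    ∃ e a, chartLine e a = L := by
  obtain ⟨i, j, hij, x, hx, y, hy, hxi, hxj, hyi, hyj⟩ := exists_mem_apply_eq hL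
  obtain ⟨e, rfl, rfl⟩ := exists_equiv_inl hij
  let a : Fin 2 × Fin 3 → ℂ := fun p => ![x, y] p.1 (e (Sum.inr p.2))
  have hvec (u : Fin 2) : vec e a u = ![x, y] u := by
    refine chart_ext (e := e) (fun u' => ?_) fun k => vec_inr e a u k
    rw [vec_inl]
    fin_cases u <;> fin_cases u' <;> simp [hxi, hxj, hyi, hyj]
  refine ⟨e, a, Submodule.eq_of_le_of_finrank_eq ?_ (by rw [finrank_chartLine, hL])⟩
  rw [chartLine_eq_span, hvec, hvec, Submodule.span_le, Set.pair_subset_iff]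
  exact ⟨hx, hy⟩

end Charts

section Curve

variable {e : Fin 2 ⊕ Fin 3 ≃ Fin 5} {F : MvPolynomial (Fin 5) ℂ}
  (hF : F.IsHomogeneous 3) (hX : IsSmooth F)
include hF hX

lemma isSingularPoint_iff_isTripleLine (L : Submodule ℂ (Fin 5 → ℂ)) :
    IsSingularPoint F L ↔ IsTripleLine F L := by
  constructor
  · rintro ⟨e, a, h, rfl, hreg⟩
    rwa [isRegularLocalRing_localization_pointIdeal_iff hF hX h, not_not] at hreg
  · intro hL
    obtain ⟨P, hP⟩ := id hL
    obtain ⟨e, a, rfl⟩ := exists_chartLine_eq hP.2.1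
    obtain ⟨c, hc, -⟩ := exists_isTangentAlong_of_planeSection hF hP
    refine ⟨e, a, (memCurve_iff_exists hF).mpr ⟨c, hc⟩, rfl, ?_⟩
    rwa [isRegularLocalRing_localization_pointIdeal_iff hF hX, not_not]

lemma isReduced_curveRing : IsReduced (CurveRing e F) := by
  refine isReduced_ofLocalizationMaximal _ fun P hP => ?_
  obtain ⟨a, ha⟩ := isMaximal_iff_eq_vanishingIdeal_singleton.mp
    (Ideal.comap_isMaximal_of_surjective _ Ideal.Quotient.mk_surjective (K := P))
  have h : MemCurve e F a := fun f hf => by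
    have hfP : f ∈ P.comap (Ideal.Quotient.mk (curveIdeal e F)) := by
      rw [Ideal.mem_comap, Ideal.Quotient.eq_zero_iff_mem.mpr hf]
      exact P.zero_mem
    rw [ha] at hfP
    exact mem_vanishingIdeal_singleton_iff a f |>.mp hfP
  have hPa : P = pointIdeal h := by
    refine Ideal.comap_injective_of_surjective _ Ideal.Quotient.mk_surjective ?_
    rw [comap_pointIdeal, ha]
    exact Ideal.ext fun f => mem_vanishingIdeal_singleton_iff a f
  subst hPa
  exact isReduced_localization_pointIdeal hF hX h

end Curve

end CubicThreefold

end

theorem theorem1 (F : MvPolynomial (Fin 5) ℂ) (hF : F.IsHomogeneous 3)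
    (hX : CubicThreefold.IsSmooth F) :
    -- the closed points of the curve `M(X)` are the lines of the second type
    (∀ (e : Fin 2 ⊕ Fin 3 ≃ Fin 5) (a : Fin 2 × Fin 3 → ℂ),
      CubicThreefold.MemCurve e F a ↔
        CubicThreefold.IsSecondType F (CubicThreefold.chartLine e a)) ∧
    -- the singular points of `M(X)` are exactly the triple lines
    (∀ L : Submodule ℂ (Fin 5 → ℂ),
      CubicThreefold.IsSingularPoint F L ↔ CubicThreefold.IsTripleLine F L) ∧
    -- `M(X)` is reduced
    (∀ e : Fin 2 ⊕ Fin 3 ≃ Fin 5, IsReduced (CubicThreefold.CurveRing e F)) :=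
  ⟨fun _ _ => CubicThreefold.memCurve_iff_isSecondType hF hX,
    CubicThreefold.isSingularPoint_iff_isTripleLine hF hX,
    fun _ => CubicThreefold.isReduced_curveRing hF hX⟩
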